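/- **Theorem 1.2 (Relaxation).** Let $\Omega\subset\mathbb R^d$ be open with $\mathcal L^d(\partial\Omega)=0$ and $\mathcal L^d(\Omega)<\infty$. Let $\mathcal M(\Omega;\mathbb R^N)$ be the space of $\mathbb R^N$-valued Radon measures on $\Omega$ of finite mass; for $\mu\in\mathcal M(\Omega;\mathbb R^N)$ write $\mu=\frac{d\mu}{d\mathcal L^d}\mathcal L^d+\mu^s$ for its Radon–Nikodým decomposition with respect to $\mathcal L^d$, and $\langle\mu\rangle(\Omega)=\int_\Omega\sqrt{1+|\frac{d\mu}{d\mathcal L^d}|^2}\,dx+|\mu^s|(\Omega)$. Weak* convergence $\mu_j\overset{*}{\rightharpoonup}\mu$ means $\int\varphi\cdot d\mu_j\to\int\varphi\cdot d\mu$ for all $\varphi\in C_0(\Omega;\mathbb R^N)$; $\mu_j\to\mu$ area-strictly means that moreover $\langle\mu_j\rangle(\Omega)\to\langle\mu\rangle(\Omega)$. Let $\mathcal A u=\sum_\alpha a_\alpha(x)\,\partial^\alpha u$ (a finite sum) be a linear partial differential operator on $\Omega$, from $\mathbb R^N$-valued to $\mathbb R^n$-valued functions, with matrix coefficients $a_\alpha\in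 C^{|\alpha|}(\Omega)$ (for instance constant ones). Put $$\ker\mathcal A=\{u\in L^1(\Omega;\mathbb R^N):\mathcal A u=0\},\qquad \ker_{\mathcal M}\mathcal A=\{\mu\in\mathcal M(\Omega;\mathbb R^N):\mathcal A\mu=0\},$$ both in the sense of distributions on $\Omega$, and assume (H2) for every $\mu\in\ker_{\mathcal M}\mathcal A$ there is a sequence $(u_j)\subset\ker\mathcal A$ such that $u_j\mathcal L^d\to\mu$ area-strictly. Let $u_0\in L^1(\Omega;\mathbb R^N)$ with $\mathcal A u_0\in L^1(\Omega;\mathbb R^n)$. Let $f:\Omega\times\mathbb R^N\to[0,\infty)$ be continuous, with $f(x,\cdot)$ convex for every $x\in\Omega$, and assume that for some $M>0$ and some function $\omega$ with $\omega(t)\to0$ as $t\downarrow0$, $$\tfrac1M(|z|-1)\le f(x,z)\le M(1+|z|),\qquad |f(x,z)-f(y,z)|\le\omega(|x-y|)(1+|z|)$$ for all $x,y\in\Omega$, $z\in\mathbb R^N$. Set $\mathcal F[u]=\int_\Omega f(x,u(x))\,dx$ for $u\in u_0+\ker\mathcal A$. Then the recession function $$f^\infty(x,z)=\lim_{\substack{x'\to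 x\\ t\to\infty}}\frac{f(x',tz)}{t}$$ exists for all $(x,z)\in\Omega\times\mathbb R^N$, and for every $\mu\in u_0\mathcal L^d+\ker_{\mathcal M}\mathcal A$ the relaxation $$\overline{\mathcal F}[\mu]=\inf\Big\{\liminf_{j\to\infty}\mathcal F[u_j]\;:\;u_j\in u_0+\ker\mathcal A,\ u_j\mathcal L^d\overset{*}{\rightharpoonup}\mu\Big\}$$ is given by $$\overline{\mathcal F}[\mu]=\int_\Omega f\Big(x,\frac{d\mu}{d\mathcal L^d}(x)\Big)dx+\int_\Omega f^\infty\Big(x,\frac{d\mu^s}{d|\mu^s|}(x)\Big)d|\mu^s|(x).$$ The same formula holds when, in the definition of $\overline{\mathcal F}$, the test functions $C_0(\Omega;\mathbb R^N)$ are replaced by the bounded continuous functions $C_b(\Omega;\mathbb R^N)$. -/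

import Mathlib

open MeasureTheory Filter Topology TopologicalSpace
open scoped ENNReal ZeroAtInfty BoundedContinuousFunction Distributions

namespace LinearGrowth

noncomputable section

/-- The Euclidean space `ℝᵏ`. -/
abbrev Euc (k : ℕ) : Type := EuclideanSpace ℝ (Fin k)

/-! ### Linear partial differential operators -/

/-- The partial derivative `∂ᵢ g`. -/
def partialDeriv {d : ℕ} {F : Type*} [NormedAddCommGroup F] [NormedSpace ℝ F]
    (i : Fin d) (g : Euc d → F) : Euc d → F :=
  fun x => lineDeriv ℝ g x (EuclideanSpace.single i 1)

/-- The partial derivative `∂^α g = ∂₁^(α₁) ⋯ ∂_d^(α_d) g` of multi-index `α`. -/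
def multiDeriv {d : ℕ} {F : Type*} [NormedAddCommGroup F] [NormedSpace ℝ F]
    (α : Fin d → ℕ) (g : Euc d → F) : Euc d → F :=
  (List.finRange d).foldr (fun i h => (partialDeriv i)^[α i] h) g

/-- A linear partial differential operator `𝒜 u = ∑_α a_α ∂^α u` of arbitrary order on the open
set `Ω ⊆ ℝᵈ`, acting on `ℝᴺ`-valued functions with values in `ℝⁿ`-valued ones. The coefficients
may depend on `x`; `a_α` is only required to be of class `C^|α|` in `Ω`, which is what is needed
for `𝒜` to act on measures in the sense of distributions. -/
structure LinearPDO {d : ℕ} (Ω : Opens (Euc d)) (N n : ℕ) where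
  /-- the finitely many multi-indices that occur -/
  idx : Finset (Fin d → ℕ)
  /-- the coefficients `a_α(x)` -/
  coeff : (Fin d → ℕ) → Euc d → (Euc N →L[ℝ] Euc n)
  contDiffOn_coeff : ∀ α ∈ idx, ContDiffOn ℝ ((∑ i, α i : ℕ) : ℕ∞) (coeff α) (Ω : Set (Euc d))

variable {d N n : ℕ} {Ω : Opens (Euc d)}

/-- The Lebesgue measure `ℒᵈ` on `Ω`. -/
def leb (Ω : Opens (Euc d)) : Measure Ω := (volume : Measure (Euc d)).comap Subtype.val

/-- The formal adjoint `𝒜* φ = ∑_α (-1)^|α| ∂^α (a_αᵀ φ)`, evaluated on a test function. -/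
def LinearPDO.formalAdjoint (A : LinearPDO Ω N n) (φ : 𝓓(Ω, Euc n)) : Euc d → Euc N :=
  fun x => ∑ α ∈ A.idx, (-1 : ℝ) ^ (∑ i, α i) •
    multiDeriv α (fun y => ContinuousLinearMap.adjoint (A.coeff α y) (φ y)) x

/-- `𝒜 u = w` in `Ω` in the sense of distributions, for (integrable) functions `u`, `w`. -/
def LinearPDO.WeakEq (A : LinearPDO Ω N n) (u : Ω → Euc N) (w : Ω → Euc n) : Prop :=
  ∀ φ : 𝓓(Ω, Euc n),
    ∫ x : Ω, inner ℝ (u x) (A.formalAdjoint φ x) ∂(leb Ω) =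
      ∫ x : Ω, inner ℝ (w x) (φ (x : Euc d)) ∂(leb Ω)

/-- `u ∈ W^{𝒜,1}(Ω)`: both `u` and `𝒜 u` are integrable. -/
def LinearPDO.MemW1 (A : LinearPDO Ω N n) (u : Ω → Euc N) : Prop :=
  Integrable u (leb Ω) ∧ ∃ w : Ω → Euc n, Integrable w (leb Ω) ∧ A.WeakEq u w

/-- `u ∈ ker 𝒜`: `u ∈ L¹(Ω; ℝᴺ)` and `𝒜 u = 0` in the sense of distributions. -/
def LinearPDO.MemKer (A : LinearPDO Ω N n) (u : Ω → Euc N) : Prop :=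
  Integrable u (leb Ω) ∧ A.WeakEq u 0

/-! ### Vector-valued measures

`𝓜(Ω; ℝᴺ)` is `VectorMeasure Ω (Euc N)`: countably additive Borel set functions with values in
`ℝᴺ`; they automatically have finite total variation `VectorMeasure.variation`. -/

/-- The pairing `⟨μ, φ⟩ = ∫_Ω φ · dμ`. -/
def pairing (μ : VectorMeasure Ω (Euc N)) (φ : Ω → Euc N) : ℝ :=
  μ.integral φ (innerSL ℝ)

/-- `μ ∈ ker_𝓜 𝒜`: `𝒜 μ = 0` in `Ω` in the sense of distributions. -/
def LinearPDO.MemKerMeas (A : LinearPDO Ω N n) (μ : VectorMeasure Ω (Euc N)) : Prop :=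
  ∀ φ : 𝓓(Ω, Euc n), pairing μ (fun x => A.formalAdjoint φ x) = 0

/-- The measure `u ℒᵈ` on `Ω`. -/
def toMeas (u : Ω → Euc N) : VectorMeasure Ω (Euc N) :=
  (leb Ω).withDensityᵥ u

/-- The `i`-th component of a vector measure. -/
def component (μ : VectorMeasure Ω (Euc N)) (i : Fin N) : SignedMeasure Ω :=
  μ.mapRange (AddMonoidHom.mk' (fun v : Euc N => v i) (fun _ _ => rfl))
    (show Continuous (fun v : Euc N => v i) by fun_prop)

theorem component_apply (μ : VectorMeasure Ω (Euc N)) (i : Fin N) (s : Set Ω) :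
    component μ i s = μ s i := rfl

/-- The Radon-Nikodym derivative `dμ/dm` of a vector measure with respect to a positive one. -/
def density (μ : VectorMeasure Ω (Euc N)) (m : Measure Ω) : Ω → Euc N :=
  fun x => WithLp.toLp 2 (fun i => (component μ i).rnDeriv m x)

/-- The singular part `μˢ = μ - (dμ/dℒᵈ) ℒᵈ`. -/
def singularPart (μ : VectorMeasure Ω (Euc N)) : VectorMeasure Ω (Euc N) :=
  μ - toMeas (density μ (leb Ω))

/-- Weak* convergence in `𝓜(Ω; ℝᴺ) = C₀(Ω; ℝᴺ)*`. -/
def WeakStarTendsto (μ : ℕ → VectorMeasure Ω (Euc N)) (ν : VectorMeasure Ω (Euc N)) : Prop :=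
  ∀ φ : C₀(Ω, Euc N), Tendsto (fun j => pairing (μ j) φ) atTop (𝓝 (pairing ν φ))

/-- Convergence in duality with the bounded continuous functions `C_b(Ω; ℝᴺ)`. -/
def NarrowTendsto (μ : ℕ → VectorMeasure Ω (Euc N)) (ν : VectorMeasure Ω (Euc N)) : Prop :=
  ∀ φ : Ω →ᵇ Euc N, Tendsto (fun j => pairing (μ j) φ) atTop (𝓝 (pairing ν φ))

/-- The area functional `⟨μ⟩(Ω) = ∫_Ω √(1 + |dμ/dℒᵈ|²) dx + |μˢ|(Ω)`. -/
def area (μ : VectorMeasure Ω (Euc N)) : ℝ≥0∞ :=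
  (∫⁻ x : Ω, ENNReal.ofReal (Real.sqrt (1 + ‖density μ (leb Ω) x‖ ^ 2)) ∂(leb Ω)) +
    (singularPart μ).variation Set.univ

/-- Area-strict convergence. -/
def AreaStrictTendsto (μ : ℕ → VectorMeasure Ω (Euc N)) (ν : VectorMeasure Ω (Euc N)) : Prop :=
  WeakStarTendsto μ ν ∧ Tendsto (fun j => area (μ j)) atTop (𝓝 (area ν))

/-- Every `𝒜`-free measure is the area-strict limit of a sequence of `𝒜`-free integrable
functions. -/
def LinearPDO.AreaStrictApprox (A : LinearPDO Ω N n) : Prop :=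
  ∀ μ : VectorMeasure Ω (Euc N), A.MemKerMeas μ →
    ∃ u : ℕ → Ω → Euc N, (∀ j, A.MemKer (u j)) ∧ AreaStrictTendsto (fun j => toMeas (u j)) μ

/-! ### The functionals -/

/-- `ℱ[u] = ∫_Ω f(x, u(x)) dx`, for a non-negative integrand `f`. -/
def energy (f : Ω → Euc N → ℝ) (u : Ω → Euc N) : ℝ≥0∞ :=
  ∫⁻ x : Ω, ENNReal.ofReal (f x (u x)) ∂(leb Ω)

/-- The relaxation
`μ ↦ inf { liminf_j ℱ[u_j] : u_j ∈ u₀ + ker 𝒜, u_j ℒᵈ → μ }` of `ℱ` from `u₀ + ker 𝒜`,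
with respect to the sequential convergence `conv` of measures. -/
def relaxation (conv : (ℕ → VectorMeasure Ω (Euc N)) → VectorMeasure Ω (Euc N) → Prop)
    (A : LinearPDO Ω N n) (f : Ω → Euc N → ℝ) (u₀ : Ω → Euc N)
    (μ : VectorMeasure Ω (Euc N)) : ℝ≥0∞ :=
  ⨅ (u : ℕ → Ω → Euc N) (_ : ∀ j, A.MemKer (u j - u₀)) (_ : conv (fun j => toMeas (u j)) μ),
    liminf (fun j => energy f (u j)) atTop

/-- The recession function `f^∞(x, z) = lim f(x', t z) / t` as `x' → x` in `Ω` and `t → ∞`. -/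
def recession (f : Ω → Euc N → ℝ) (x : Ω) (z : Euc N) : ℝ :=
  limUnder (𝓝 x ×ˢ atTop) (fun p : Ω × ℝ => f p.1 (p.2 • z) / p.2)

/-- `μ ↦ ∫_Ω f(x, dμ/dℒᵈ) dx + ∫_Ω f^∞(x, dμˢ/d|μˢ|) d|μˢ|`. -/
def relaxedEnergy (f : Ω → Euc N → ℝ) (μ : VectorMeasure Ω (Euc N)) : ℝ≥0∞ :=
  (∫⁻ x : Ω, ENNReal.ofReal (f x (density μ (leb Ω) x)) ∂(leb Ω)) +
    ∫⁻ x : Ω, ENNReal.ofReal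
      (recession f x (density (singularPart μ) (singularPart μ).variation x))
      ∂(singularPart μ).variation

end

end LinearGrowth

/-!
The relaxation is sandwiched. Narrow convergence implies weak* convergence, so it is enough to bound
the weak* relaxation from below by the relaxed energy and the narrow one from above.

Lower bound. By convexity `f (x, ·)` lies above its tangents, and the modulus of continuity lets the
slopes of these tangents at a continuous function `w` be chosen continuous in `x`, up to a small
multiple of `1 + |z|` (`exists_continuous_approx_subgradient`). The tangents are affine in `z`, so
their integrals pass to the weak* limit `μ = ρ ℒᵈ + σ |μˢ|`. As `|μˢ|` and `ℒᵈ` are mutually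
singular, `w` can be close to `ρ` in `L¹(ℒᵈ)` and to `k σ` in `L¹(|μˢ|)` at once; `k → ∞` produces
the recession function on the singular part (`integral_add_integral_recession_le`). The differential
constraint is not needed here. Coercivity of `f` supplies the `L¹` bound that absorbs the error.

Upper bound. Translating by `u₀`, the hypothesis on `ker 𝒜` gives `v_j ∈ ker 𝒜` with
`v_j ℒᵈ → μ - u₀ ℒᵈ` area-strictly, and `u₀ + v_j` is a recovery sequence by Reshetnyak's continuity
theorem. The proof of the latter again compares with a continuous `w`: the excess
`|(1, z)| - ν · (1, z)`, where `ν` is the direction of `(1, w)`, bounds the squared distance between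
the directions of `(1, z)` and `(1, w)` (`areaIntegrand_mul_norm_sq_sub_le`); area-strict
convergence makes its integral along `v_j` converge to its value for the limit measure, which is
small for a suitable `w` (`exists_small_excess`). Every continuous function of the direction may
then be frozen to that of `w`, which leaves an affine integrand (`tendsto_integral_of_uniform`).
Integrands of linear growth reduce to this case by their perspective, which is continuous because
the recession function is a limit in `(x, t)` jointly (`continuous_perspective`). The integrand
`φ(x) · z`, its own recession function, shows that the recovery sequence converges even narrowly.

The dictionary between vector measures and densities rests on `|u m| = |u| m`, which gives unit
length of the density of a vector measure with respect to its variation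
(`norm_density_variation`).
-/

namespace LinearGrowth

/-! ### Convex functions of linear growth -/

section Convex

variable {E : Type*} [NormedAddCommGroup E] [InnerProductSpace ℝ E] [CompleteSpace E]

/-- A continuous convex function has a subgradient at every point: separate `(w, g w)` from the
open strict epigraph. -/
theorem exists_subgradient {g : E → ℝ} (hc : Continuous g) (hconv : ConvexOn ℝ Set.univ g) (w : E) :
    ∃ b : E, ∀ z, g w + inner ℝ b (z - w) ≤ g z := by
  have hopen : IsOpen {q : E × ℝ | q.1 ∈ Set.univ ∧ g q.1 < q.2} := by
    simpa using isOpen_lt (hc.comp continuous_fst) continuous_snd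
  obtain ⟨ℓ, hℓ⟩ := geometric_hahn_banach_open_point (x := (w, g w))
    hconv.convex_strict_epigraph hopen (by simp)
  have key : ∀ z t, g z < t → ℓ (z, 0) + t * ℓ (0, 1) < ℓ (w, 0) + g w * ℓ (0, 1) := by
    intro z t hzt
    have h := hℓ (z, t) ⟨trivial, hzt⟩
    have split : ∀ (y : E) (s : ℝ), ℓ (y, s) = ℓ (y, 0) + s * ℓ (0, 1) := by
      intro y s
      rw [← smul_eq_mul, ← map_smul, ← map_add]
      simp
    rwa [split z, split w] at h
  have hneg : ℓ (0, 1) < 0 := by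
    have := key w (g w + 1) (by linarith)
    linarith
  have key' : ∀ z, ℓ (z, 0) + g z * ℓ (0, 1) ≤ ℓ (w, 0) + g w * ℓ (0, 1) := by
    intro z
    refine le_of_forall_pos_le_add fun ε hε => ?_
    have h := key z (g z + ε / (-ℓ (0, 1))) (by
      have : 0 < ε / (-ℓ (0, 1)) := div_pos hε (by linarith)
      linarith)
    have h2 : ε / (-ℓ (0, 1)) * ℓ (0, 1) = -ε := by
      rw [div_neg, neg_mul, div_mul_cancel₀ _ hneg.ne]
    nlinarith
  let ℓ₁ : StrongDual ℝ E := (-ℓ (0, 1))⁻¹ • (ℓ.comp (ContinuousLinearMap.inl ℝ E ℝ))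
  refine ⟨(InnerProductSpace.toDual ℝ E).symm ℓ₁, fun z => ?_⟩
  rw [InnerProductSpace.toDual_symm_apply]
  have h1 : ℓ₁ (z - w) = (-ℓ (0, 1))⁻¹ * (ℓ (z, 0) - ℓ (w, 0)) := by
    have : ℓ (z - w, 0) = ℓ (z, 0) - ℓ (w, 0) := by rw [← map_sub]; simp
    simp [ℓ₁, this]
  have h3 : (-ℓ (0, 1))⁻¹ * (ℓ (z, 0) - ℓ (w, 0)) ≤ g z - g w := by
    rw [inv_mul_le_iff₀ (by linarith)]
    have := key' z
    linarith
  rw [h1]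
  linarith

omit [CompleteSpace E] in
/-- Linear growth bounds the subgradients: follow `g` along the ray from `w` in direction `b`. -/
theorem norm_subgradient_le {g : E → ℝ} {M : ℝ} (hM : 0 ≤ M) (h0 : ∀ z, 0 ≤ g z)
    (hg : ∀ z, g z ≤ M * (1 + ‖z‖)) {w b : E} (hb : ∀ z, g w + inner ℝ b (z - w) ≤ g z) :
    ‖b‖ ≤ M := by
  by_contra! hlt
  have hbpos : 0 < ‖b‖ := hM.trans_lt hlt
  set a := ‖b‖ * (‖b‖ - M) with ha
  have hapos : 0 < a := mul_pos hbpos (by linarith)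
  have hray : ∀ t : ℝ, 0 ≤ t → t * a ≤ M * (1 + ‖w‖) := by
    intro t ht
    have h1 := hb (w + t • b)
    rw [add_sub_cancel_left, inner_smul_right, real_inner_self_eq_norm_sq] at h1
    have h2 := hg (w + t • b)
    have h3 : ‖w + t • b‖ ≤ ‖w‖ + t * ‖b‖ := by
      refine (norm_add_le _ _).trans ?_
      rw [norm_smul, Real.norm_of_nonneg ht]
    have h4 := mul_le_mul_of_nonneg_left h3 hM
    have h5 := h0 w
    nlinarith
  have h6 := hray ((M * (1 + ‖w‖) + 1) / a) (by positivity)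
  rw [div_mul_cancel₀ _ hapos.ne'] at h6
  linarith

/-- A non-negative convex function with `g z ≤ M (1 + |z|)` is `M`-Lipschitz. -/
theorem abs_sub_le_of_convex {g : E → ℝ} {M : ℝ} (hM : 0 ≤ M) (hc : Continuous g)
    (hconv : ConvexOn ℝ Set.univ g) (h0 : ∀ z, 0 ≤ g z) (hg : ∀ z, g z ≤ M * (1 + ‖z‖)) (z w : E) :
    |g z - g w| ≤ M * ‖z - w‖ := by
  have key : ∀ z w : E, g w - g z ≤ M * ‖z - w‖ := by
    intro z w
    obtain ⟨b, hb⟩ := exists_subgradient hc hconv w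
    have h1 := hb z
    have h2 := (abs_le.1 (abs_real_inner_le_norm b (z - w))).1
    have h3 := mul_le_mul_of_nonneg_right (norm_subgradient_le hM h0 hg hb) (norm_nonneg (z - w))
    linarith
  rw [abs_le]
  have h1 := key z w
  have h2 := key w z
  rw [norm_sub_rev] at h2
  constructor <;> linarith

omit [CompleteSpace E] in
/-- The difference quotients `g (t z) / t` of a convex function of linear growth converge as
`t → ∞`, since `(g (t z) - g 0) / t` is monotone and bounded. -/
theorem exists_tendsto_div_atTop {g : E → ℝ} {M : ℝ}
    (hconv : ConvexOn ℝ Set.univ g) (hlip : ∀ z w, |g z - g w| ≤ M * ‖z - w‖) (z : E) :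
    ∃ l, Tendsto (fun t : ℝ => g (t • z) / t) atTop (𝓝 l) := by
  -- Freezing the quotient for `t ≤ 1` makes it monotone on all of `ℝ`.
  let q : ℝ → ℝ := fun t => (g ((max t 1) • z) - g 0) / max t 1
  have hmono : Monotone q := by
    intro s t hst
    have hs : 0 < max s 1 := by positivity
    have ht : 0 < max t 1 := by positivity
    have hst' : max s 1 ≤ max t 1 := max_le_max_right _ hst
    simp only [q]
    generalize max s 1 = s' at *
    generalize max t 1 = t' at *
    rw [div_le_div_iff₀ hs ht]
    have ha : 0 ≤ s' / t' := by positivity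
    have hb : 0 ≤ 1 - s' / t' := by rw [sub_nonneg, div_le_one ht]; exact hst'
    have h := hconv.2 (Set.mem_univ (t' • z)) (Set.mem_univ (0 : E)) ha hb (by ring)
    rw [smul_zero, add_zero, smul_smul, div_mul_cancel₀ _ ht.ne', smul_eq_mul, smul_eq_mul] at h
    have h2 := mul_le_mul_of_nonneg_right h ht.le
    have h3 : (s' / t' * g (t' • z) + (1 - s' / t') * g 0) * t'
        = s' * g (t' • z) + (t' - s') * g 0 := by field_simp
    nlinarith
  have hbdd : BddAbove (Set.range q) := by
    refine ⟨M * ‖z‖, ?_⟩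
    rintro _ ⟨t, rfl⟩
    have ht : 0 < max t 1 := by positivity
    simp only [q]
    rw [div_le_iff₀ ht]
    refine (le_abs_self _).trans ((hlip _ _).trans (le_of_eq ?_))
    rw [sub_zero, norm_smul, Real.norm_of_nonneg ht.le]
    ring
  have h1 := tendsto_atTop_ciSup hmono hbdd
  have h2 : Tendsto (fun t : ℝ => g 0 / t) atTop (𝓝 0) := tendsto_const_nhds.div_atTop tendsto_id
  refine ⟨_, (h1.add h2).congr' ?_⟩
  filter_upwards [eventually_ge_atTop 1] with t ht
  have : max t 1 = t := max_eq_left ht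
  simp only [q, this]
  ring

end Convex

/-! ### Convex integrands with a modulus of continuity -/

section Integrand

variable {X E : Type*} [PseudoMetricSpace X] [NormedAddCommGroup E] [InnerProductSpace ℝ E]
  [CompleteSpace E]

omit [CompleteSpace E] in
/-- The modulus of continuity in `x` makes the recession limit locally uniform in `x`. -/
theorem tendsto_prod_recession {f : X → E → ℝ}
    (hloc : ∀ x, ∀ η > 0, ∀ᶠ y in 𝓝 x, ∀ z, |f x z - f y z| ≤ η * (1 + ‖z‖)) {x : X} {z : E} {l : ℝ}
    (hl : Tendsto (fun t : ℝ => f x (t • z) / t) atTop (𝓝 l)) :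
    Tendsto (fun q : X × ℝ => f q.1 (q.2 • z) / q.2) (𝓝 x ×ˢ atTop) (𝓝 l) := by
  have hdiff : Tendsto (fun q : X × ℝ => f q.1 (q.2 • z) / q.2 - f x (q.2 • z) / q.2)
      (𝓝 x ×ˢ atTop) (𝓝 0) := by
    rw [Metric.tendsto_nhds]
    intro ε hε
    have hη : 0 < ε / (2 * (1 + ‖z‖)) := by positivity
    filter_upwards [(hloc x _ hη).prod_mk (eventually_ge_atTop (1 : ℝ))] with q hq
    obtain ⟨hq1, hq2⟩ := hq
    have hpos : 0 < q.2 := by linarith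
    rw [dist_zero_right, Real.norm_eq_abs, ← sub_div, abs_div, abs_of_pos hpos, div_lt_iff₀ hpos,
      abs_sub_comm]
    refine (hq1 _).trans_lt ?_
    rw [norm_smul, Real.norm_of_nonneg hpos.le]
    have h1 : 1 + q.2 * ‖z‖ ≤ q.2 * (1 + ‖z‖) := by nlinarith [norm_nonneg z]
    calc ε / (2 * (1 + ‖z‖)) * (1 + q.2 * ‖z‖)
        ≤ ε / (2 * (1 + ‖z‖)) * (q.2 * (1 + ‖z‖)) := by gcongr
      _ = ε / 2 * q.2 := by field_simp
      _ < ε * q.2 := by nlinarith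
  have h2 := hdiff.add (hl.comp (tendsto_snd (f := 𝓝 x)))
  simpa using h2

/-- Along a continuous map `w`, the subgradients of `f (x, ·)` at `w x` can be chosen continuously
in `x`, up to an error `η (1 + |z|)`: near `x` the subgradient at `x` itself works, and the
admissible vectors form a convex set, so a partition of unity glues the local choices. -/
theorem exists_continuous_approx_subgradient {f : X → E → ℝ}
    (hf : Continuous fun q : X × E => f q.1 q.2) (hconv : ∀ x, ConvexOn ℝ Set.univ (f x))
    (h0 : ∀ x z, 0 ≤ f x z) {M : ℝ} (hM : 0 ≤ M) (hg : ∀ x z, f x z ≤ M * (1 + ‖z‖))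
    (hloc : ∀ x, ∀ η > 0, ∀ᶠ y in 𝓝 x, ∀ z, |f x z - f y z| ≤ η * (1 + ‖z‖))
    {w : X → E} (hw : Continuous w) {η : ℝ} (hη : 0 < η) :
    ∃ b : C(X, E), ∀ x, ‖b x‖ ≤ M ∧
      ∀ z, f x (w x) + inner ℝ (b x) (z - w x) ≤ f x z + η * (1 + ‖z‖) := by
  refine exists_continuous_forall_mem_convex_of_local_const
    (t := fun x => {b : E | ‖b‖ ≤ M ∧
      ∀ z, f x (w x) + inner ℝ b (z - w x) ≤ f x z + η * (1 + ‖z‖)}) ?_ ?_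
  · intro x b hb c hc s t hs ht hst
    refine ⟨?_, fun z => ?_⟩
    · calc ‖s • b + t • c‖ ≤ s * ‖b‖ + t * ‖c‖ := by
            refine (norm_add_le _ _).trans ?_
            rw [norm_smul, norm_smul, Real.norm_of_nonneg hs, Real.norm_of_nonneg ht]
        _ ≤ s * M + t * M := by gcongr; exacts [hb.1, hc.1]
        _ = M := by rw [← add_mul, hst, one_mul]
    · have h1 := mul_le_mul_of_nonneg_left (hb.2 z) hs
      have h2 := mul_le_mul_of_nonneg_left (hc.2 z) ht
      rw [inner_add_left, real_inner_smul_left, real_inner_smul_left]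
      have ht' : t = 1 - s := by linarith
      subst ht'
      linarith
  · intro x
    obtain ⟨b, hb⟩ := exists_subgradient (by fun_prop : Continuous (f x)) (hconv x) (w x)
    have hbM := norm_subgradient_le hM (h0 x) (hg x) hb
    refine ⟨b, ?_⟩
    have hfw : Continuous fun y => f y (w y) := hf.comp (continuous_id.prodMk hw)
    have e1 := Metric.tendsto_nhds.1 (hfw.tendsto x) (η / 4) (by positivity)
    have e2 := Metric.tendsto_nhds.1 (hw.tendsto x) (η / (4 * (M + 1))) (by positivity)
    filter_upwards [e1, e2, hloc x (η / 2) (by positivity)] with y h1 h2 h3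
    refine ⟨hbM, fun z => ?_⟩
    rw [Real.dist_eq] at h1
    rw [dist_eq_norm] at h2
    have h4 := hb z
    have h5 : inner ℝ b (z - w y) ≤ inner ℝ b (z - w x) + η / 4 := by
      have : z - w y = (z - w x) - (w y - w x) := by abel
      rw [this, inner_sub_right]
      have h6 := (abs_le.1 (abs_real_inner_le_norm b (w y - w x))).1
      have h7 : ‖b‖ * ‖w y - w x‖ ≤ (M + 1) * (η / (4 * (M + 1))) := by
        gcongr
        linarith
      have h8 : (M + 1) * (η / (4 * (M + 1))) = η / 4 := by field_simp
      linarith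
    have h9 := (abs_le.1 (h3 z)).2
    have h10 := (abs_le.1 h1.le).2
    nlinarith [norm_nonneg z]

end Integrand

/-! ### Approximation by compactly supported continuous functions -/

section Approximation

/-- An exhausting sequence of compactly supported cut-off functions. -/
theorem exists_seq_cutoff (X : Type*) [PseudoMetricSpace X] [LocallyCompactSpace X]
    [SecondCountableTopology X] :
    ∃ ψ : ℕ → X → ℝ, (∀ n, Continuous (ψ n)) ∧ (∀ n, HasCompactSupport (ψ n)) ∧
      (∀ n x, ψ n x ∈ Set.Icc (0 : ℝ) 1) ∧ ∀ x, ∀ᶠ n in atTop, ψ n x = 1 := by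
  let K : CompactExhaustion X := default
  have h : ∀ n, ∃ g : C(X, ℝ), Set.EqOn g 1 (K n) ∧ HasCompactSupport g ∧
      ∀ x, g x ∈ Set.Icc (0 : ℝ) 1 := by
    intro n
    obtain ⟨g, h1, h2, -, h3⟩ := exists_continuousMap_one_of_isCompact_subset_isOpen
      (K.isCompact n) isOpen_univ (Set.subset_univ _)
    exact ⟨g, h1, h2, h3⟩
  choose g h1 h2 h3 using h
  refine ⟨fun n => g n, fun n => (g n).continuous, h2, h3, fun x => ?_⟩
  filter_upwards [eventually_ge_atTop (K.find x)] with n hn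
  exact h1 n (K.subset hn (K.mem_find x))

variable {X E : Type*} [PseudoMetricSpace X] [LocallyCompactSpace X] [SecondCountableTopology X]
  [MeasurableSpace X] [BorelSpace X]
  [NormedAddCommGroup E] [InnerProductSpace ℝ E]

omit [LocallyCompactSpace X] [SecondCountableTopology X] in
theorem tendsto_integral_cutoff_mul {m : Measure X} {ψ : ℕ → X → ℝ} (hc : ∀ n, Continuous (ψ n))
    (hI : ∀ n x, ψ n x ∈ Set.Icc (0 : ℝ) 1) (h1 : ∀ x, ∀ᶠ n in atTop, ψ n x = 1)
    {g : X → ℝ} (hg : Integrable g m) :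
    Tendsto (fun n => ∫ x, ψ n x * g x ∂m) atTop (𝓝 (∫ x, g x ∂m)) := by
  refine tendsto_integral_of_dominated_convergence (fun x => ‖g x‖)
    (fun n => (hc n).aestronglyMeasurable.mul hg.aestronglyMeasurable) hg.norm
    (fun n => Eventually.of_forall fun x => ?_) (Eventually.of_forall fun x => ?_)
  · rw [norm_mul, Real.norm_of_nonneg (hI n x).1]
    exact mul_le_of_le_one_left (norm_nonneg _) (hI n x).2
  · refine tendsto_const_nhds.congr' ?_
    filter_upwards [h1 x] with n hn
    rw [hn, one_mul]

/-- For mutually singular `m` and `l`, one compactly supported continuous function approximates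
`ρ` in `L¹(m)` and `τ` in `L¹(l)` at the same time. -/
theorem exists_continuous_approx_pair {m l : Measure X} [IsFiniteMeasure m] [IsFiniteMeasure l]
    (hml : l ⟂ₘ m) {ρ τ : X → E} (hρ : Integrable ρ m) (hτ : Integrable τ l) {δ : ℝ} (hδ : 0 < δ) :
    ∃ w : X → E, Continuous w ∧ HasCompactSupport w ∧ Integrable w m ∧ Integrable w l ∧
      ∫ x, ‖ρ x - w x‖ ∂m ≤ δ ∧ ∫ x, ‖τ x - w x‖ ∂l ≤ δ := by
  classical
  obtain ⟨s, hs, hls, hms⟩ := hml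
  -- `g` represents `ρ` for `m` and `τ` for `l`, so approximate it in `L¹(m + l)`.
  set g : X → E := s.piecewise ρ τ with hg
  have hgm : g =ᵐ[m] ρ := by
    filter_upwards [compl_mem_ae_iff.2 hms] with x hx
    exact Set.piecewise_eq_of_mem _ _ _ (not_not.1 hx)
  have hgl : g =ᵐ[l] τ := by
    filter_upwards [compl_mem_ae_iff.2 hls] with x hx
    exact Set.piecewise_eq_of_notMem _ _ _ hx
  have hint : Integrable g (m + l) :=
    ((integrable_congr hgm).2 hρ).add_measure ((integrable_congr hgl).2 hτ)
  obtain ⟨w, hw1, hw2, hw3, hw4⟩ := hint.exists_hasCompactSupport_integral_sub_le hδ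
  have hwm := hw4.mono_measure (Measure.le_add_right le_rfl : m ≤ m + l)
  have hwl := hw4.mono_measure (Measure.le_add_left le_rfl : l ≤ m + l)
  have hsub : Integrable (fun x => ‖g x - w x‖) (m + l) := (hint.sub hw4).norm
  rw [integral_add_measure (hsub.mono_measure (Measure.le_add_right le_rfl))
    (hsub.mono_measure (Measure.le_add_left le_rfl))] at hw2
  have em : ∫ x, ‖g x - w x‖ ∂m = ∫ x, ‖ρ x - w x‖ ∂m :=
    integral_congr_ae (hgm.mono fun x hx => by simp only [hx])
  have el : ∫ x, ‖g x - w x‖ ∂l = ∫ x, ‖τ x - w x‖ ∂l :=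
    integral_congr_ae (hgl.mono fun x hx => by simp only [hx])
  have pm : 0 ≤ ∫ x, ‖ρ x - w x‖ ∂m := integral_nonneg fun x => norm_nonneg _
  have pl : 0 ≤ ∫ x, ‖τ x - w x‖ ∂l := integral_nonneg fun x => norm_nonneg _
  simp only [em, el] at hw2
  exact ⟨w, hw3, hw1, hwm, hwl, by linarith, by linarith⟩

omit [LocallyCompactSpace X] in
theorem integrable_inner_of_bounded {m : Measure X} {φ u : X → E} (hφ : Continuous φ) {C : ℝ}
    (hC : ∀ x, ‖φ x‖ ≤ C) (hu : Integrable u m) : Integrable (fun x => inner ℝ (φ x) (u x)) m := by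
  refine (hu.norm.const_mul C).mono' (hφ.aestronglyMeasurable.inner hu.aestronglyMeasurable)
    (Eventually.of_forall fun x => ?_)
  exact (norm_inner_le_norm _ _).trans (mul_le_mul_of_nonneg_right (hC x) (norm_nonneg _))

omit [LocallyCompactSpace X] [InnerProductSpace ℝ E] in
theorem integrable_comp_of_linear_growth {m : Measure X} [IsFiniteMeasure m] {f : X → E → ℝ}
    (hf : Continuous fun q : X × E => f q.1 q.2) {C : ℝ} (hC : ∀ x z, |f x z| ≤ C * (1 + ‖z‖))
    {u : X → E} (hu : Integrable u m) : Integrable (fun x => f x (u x)) m := by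
  refine (((integrable_const (1 : ℝ)).add hu.norm).const_mul C).mono' ?_
    (Eventually.of_forall fun x => hC x (u x))
  exact hf.comp_aestronglyMeasurable
    (continuous_id.aestronglyMeasurable.prodMk hu.aestronglyMeasurable)

/-- `u_j m` converges to `ρ m + σ l` in duality with the compactly supported continuous
functions. -/
def VagueTendsto (m l : Measure X) (u : ℕ → X → E) (ρ σ : X → E) : Prop :=
  ∀ φ : X → E, Continuous φ → HasCompactSupport φ →
    Tendsto (fun j => ∫ x, inner ℝ (φ x) (u j x) ∂m) atTop
      (𝓝 (∫ x, inner ℝ (φ x) (ρ x) ∂m + ∫ x, inner ℝ (φ x) (σ x) ∂l))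

end Approximation

/-! ### Lower semicontinuity -/

section LowerSemicontinuity

variable {X E : Type*} [PseudoMetricSpace X] [LocallyCompactSpace X] [SecondCountableTopology X]
  [MeasurableSpace X] [BorelSpace X]
  [NormedAddCommGroup E] [InnerProductSpace ℝ E]
  {m l : Measure X} [IsFiniteMeasure m]

/-- Test the energy of `u_j` with the affine minorants of `f (x, ·)` at `w x`. The cut-off that
makes their slope an admissible test function costs nothing as `f ≥ 0`; the error `η (1 + |z|)` of
the minorants is controlled by the `L¹` bound on `u_j`. -/
theorem integral_tangent_le_of_vagueTendsto {f : X → E → ℝ}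
    (hf : Continuous fun q : X × E => f q.1 q.2) (h0 : ∀ x z, 0 ≤ f x z) {M : ℝ}
    (hg : ∀ x z, f x z ≤ M * (1 + ‖z‖))
    {u : ℕ → X → E} {ρ σ : X → E} (hu : ∀ j, Integrable (u j) m) (hρ : Integrable ρ m)
    (hσ : Integrable σ l) (hconv : VagueTendsto m l u ρ σ) {c C : ℝ}
    (hfreq : ∃ᶠ j in atTop, ∫ x, f x (u j x) ∂m ≤ c ∧ ∫ x, ‖u j x‖ ∂m ≤ C)
    {w : X → E} (hwm : Integrable w m) {η : ℝ} (hη : 0 ≤ η)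
    {b : C(X, E)} (hbM : ∀ x, ‖b x‖ ≤ M)
    (hb : ∀ x z, f x (w x) + inner ℝ (b x) (z - w x) ≤ f x z + η * (1 + ‖z‖)) :
    ∫ x, (f x (w x) + inner ℝ (b x) (ρ x - w x)) ∂m + ∫ x, inner ℝ (b x) (σ x) ∂l
      ≤ c + η * (m.real Set.univ + C) := by
  have habs : ∀ x z, |f x z| ≤ M * (1 + ‖z‖) := fun x z => by
    rw [abs_of_nonneg (h0 x z)]; exact hg x z
  have ifw : Integrable (fun x => f x (w x)) m := integrable_comp_of_linear_growth hf habs hwm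
  have itan : ∀ v : X → E, Integrable v m →
      Integrable (fun x => f x (w x) + inner ℝ (b x) (v x - w x)) m := fun v hv =>
    ifw.add (integrable_inner_of_bounded b.continuous hbM (hv.sub hwm))
  have iσ := integrable_inner_of_bounded b.continuous hbM hσ
  have cut : ∀ ψ : X → ℝ, Continuous ψ → HasCompactSupport ψ → (∀ x, ψ x ∈ Set.Icc (0 : ℝ) 1) →
      ∫ x, ψ x * (f x (w x) + inner ℝ (b x) (ρ x - w x)) ∂m + ∫ x, ψ x * inner ℝ (b x) (σ x) ∂l
        ≤ c + η * (m.real Set.univ + C) := by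
    intro ψ hψ hψs hψI
    have imul : ∀ {ν : Measure X} {g : X → ℝ}, Integrable g ν →
        Integrable (fun x => ψ x * g x) ν := fun {ν g} hg =>
      hg.bdd_mul hψ.aestronglyMeasurable (c := 1) (Eventually.of_forall fun x => by
        rw [Real.norm_of_nonneg (hψI x).1]; exact (hψI x).2)
    have split : ∀ v : X → E, Integrable v m →
        ∫ x, ψ x * (f x (w x) + inner ℝ (b x) (v x - w x)) ∂m
          = ∫ x, ψ x * (f x (w x) - inner ℝ (b x) (w x)) ∂m
            + ∫ x, inner ℝ (ψ x • b x) (v x) ∂m := by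
      intro v hv
      have i1 := integrable_inner_of_bounded b.continuous hbM hv
      have i2 := integrable_inner_of_bounded b.continuous hbM hwm
      have i3 : Integrable (fun x => f x (w x) - inner ℝ (b x) (w x)) m := ifw.sub i2
      have e1 : ∀ x, inner ℝ (ψ x • b x) (v x) = ψ x * inner ℝ (b x) (v x) :=
        fun x => real_inner_smul_left _ _ _
      simp only [e1]
      rw [← integral_add (imul i3) (imul i1)]
      refine integral_congr_ae (Eventually.of_forall fun x => ?_)
      simp only [inner_sub_right]
      ring
    have hlim := (hconv (fun x => ψ x • b x) (hψ.smul b.continuous) hψs.smul_right).const_add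
      (∫ x, ψ x * (f x (w x) - inner ℝ (b x) (w x)) ∂m)
    rw [← add_assoc, ← split ρ hρ] at hlim
    have e2 : ∀ x, inner ℝ (ψ x • b x) (σ x) = ψ x * inner ℝ (b x) (σ x) :=
      fun x => real_inner_smul_left _ _ _
    simp only [e2] at hlim
    refine le_of_tendsto_of_frequently hlim (hfreq.mono fun j hj => ?_)
    rw [← split (u j) (hu j)]
    have ifu := integrable_comp_of_linear_growth hf habs (hu j)
    have i1 : Integrable (fun x => 1 + ‖u j x‖) m := (integrable_const (1 : ℝ)).add (hu j).norm
    calc ∫ x, ψ x * (f x (w x) + inner ℝ (b x) (u j x - w x)) ∂m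
        ≤ ∫ x, (f x (u j x) + η * (1 + ‖u j x‖)) ∂m := by
          refine integral_mono (imul (itan _ (hu j))) (ifu.add (i1.const_mul η)) fun x => ?_
          have h1 := mul_le_mul_of_nonneg_left (hb x (u j x)) (hψI x).1
          have h2 : 0 ≤ f x (u j x) + η * (1 + ‖u j x‖) :=
            add_nonneg (h0 _ _) (by positivity)
          have h3 := mul_le_of_le_one_left h2 (hψI x).2
          exact h1.trans h3
      _ = ∫ x, f x (u j x) ∂m + η * (m.real Set.univ + ∫ x, ‖u j x‖ ∂m) := by
          rw [integral_add ifu (i1.const_mul η), integral_const_mul,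
            integral_add (integrable_const _) (hu j).norm]
          simp
      _ ≤ c + η * (m.real Set.univ + C) := by
          gcongr
          exacts [hj.1, hj.2]
  obtain ⟨ψ, hψ, hψs, hψI, hψ1⟩ := exists_seq_cutoff X
  exact le_of_tendsto' ((tendsto_integral_cutoff_mul hψ hψI hψ1 (itan ρ hρ)).add
    (tendsto_integral_cutoff_mul hψ hψI hψ1 iσ)) fun n => cut _ (hψ n) (hψs n) (hψI n)

/-- Lower semicontinuity of the relaxed energy along a vaguely convergent sequence that is bounded
in `L¹`, with the recession function `r` of `f` on the singular part. The minorants are taken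
at a function `w` close to `ρ` in `L¹(m)` and to `k σ` in `L¹(l)`, with `k → ∞`. -/
theorem integral_add_integral_recession_le [CompleteSpace E] [IsFiniteMeasure l] {f r : X → E → ℝ}
    (hf : Continuous fun q : X × E => f q.1 q.2) (hconvex : ∀ x, ConvexOn ℝ Set.univ (f x))
    (h0 : ∀ x z, 0 ≤ f x z) {M : ℝ} (hM : 0 ≤ M) (hg : ∀ x z, f x z ≤ M * (1 + ‖z‖))
    (hloc : ∀ x, ∀ η > 0, ∀ᶠ y in 𝓝 x, ∀ z, |f x z - f y z| ≤ η * (1 + ‖z‖))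
    (hr : ∀ x z, Tendsto (fun t : ℝ => f x (t • z) / t) atTop (𝓝 (r x z)))
    (hml : l ⟂ₘ m) {u : ℕ → X → E} {ρ σ : X → E} (hu : ∀ j, Integrable (u j) m)
    (hρ : Integrable ρ m) (hσ : Integrable σ l) (hconv : VagueTendsto m l u ρ σ) {c C : ℝ}
    (hfreq : ∃ᶠ j in atTop, ∫ x, f x (u j x) ∂m ≤ c ∧ ∫ x, ‖u j x‖ ∂m ≤ C) :
    ∫ x, f x (ρ x) ∂m + ∫ x, r x (σ x) ∂l ≤ c := by
  have habs : ∀ x z, |f x z| ≤ M * (1 + ‖z‖) := fun x z => by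
    rw [abs_of_nonneg (h0 x z)]; exact hg x z
  have hC : 0 ≤ C := by
    obtain ⟨j, -, hj⟩ := hfreq.exists
    exact (integral_nonneg fun x => norm_nonneg _).trans hj
  have ifρ := integrable_comp_of_linear_growth hf habs hρ
  have main : ∀ k : ℝ, 0 < k →
      ∫ x, f x (ρ x) ∂m + (∫ x, f x (k • σ x) ∂l) / k ≤ c + M * l.real Set.univ / k := by
    intro k hk
    have ikσ : Integrable (fun x => k • σ x) l := hσ.smul k
    have ifσ := integrable_comp_of_linear_growth hf habs ikσ
    have bound : ∀ ε > 0, ∫ x, f x (ρ x) ∂m - 2 * M * ε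
        + (∫ x, f x (k • σ x) ∂l - ((M + ε) * l.real Set.univ + 2 * M * ε)) / k
          ≤ c + ε * (m.real Set.univ + C) := by
      intro ε hε
      obtain ⟨w, hw, -, hwm, hwl, hw1, hw2⟩ := exists_continuous_approx_pair hml hρ ikσ hε
      obtain ⟨b, hb⟩ := exists_continuous_approx_subgradient hf hconvex h0 hM hg hloc hw hε
      refine le_trans ?_ (integral_tangent_le_of_vagueTendsto hf h0 hg hu hρ hσ hconv hfreq hwm
        hε.le (fun x => (hb x).1) fun x => (hb x).2)
      have hlip : ∀ x z z', f x z - f x z' ≤ M * ‖z - z'‖ := fun x z z' =>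
        (le_abs_self _).trans (abs_sub_le_of_convex hM (by fun_prop) (hconvex x) (h0 x) (hg x) z z')
      have hin : ∀ x v, |inner ℝ (b x) v| ≤ M * ‖v‖ := fun x v =>
        (abs_real_inner_le_norm _ _).trans (mul_le_mul_of_nonneg_right (hb x).1 (norm_nonneg _))
      refine add_le_add ?_ ?_
      · have i1 : Integrable (fun x => ‖ρ x - w x‖) m := (hρ.sub hwm).norm
        calc ∫ x, f x (ρ x) ∂m - 2 * M * ε
            ≤ ∫ x, f x (ρ x) ∂m - 2 * M * ∫ x, ‖ρ x - w x‖ ∂m := by gcongr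
          _ = ∫ x, (f x (ρ x) - 2 * M * ‖ρ x - w x‖) ∂m := by
              rw [integral_sub ifρ (i1.const_mul _), integral_const_mul]
          _ ≤ _ := by
              refine integral_mono (ifρ.sub (i1.const_mul _))
                ((integrable_comp_of_linear_growth hf habs hwm).add
                  (integrable_inner_of_bounded b.continuous (fun x => (hb x).1) (hρ.sub hwm)))
                fun x => ?_
              have h1 := hlip x (ρ x) (w x)
              have h2 := (abs_le.1 (hin x (ρ x - w x))).1
              simp only
              linarith
      · have i1 : Integrable (fun x => ‖k • σ x - w x‖) l := (ikσ.sub hwl).norm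
        have i3 : Integrable (fun x => (M + ε) + 2 * M * ‖k • σ x - w x‖) l :=
          (integrable_const _).add (i1.const_mul _)
        have i2 : Integrable (fun x => f x (k • σ x) - ((M + ε) + 2 * M * ‖k • σ x - w x‖)) l :=
          ifσ.sub i3
        calc (∫ x, f x (k • σ x) ∂l - ((M + ε) * l.real Set.univ + 2 * M * ε)) / k
            ≤ (∫ x, f x (k • σ x) ∂l
                - ((M + ε) * l.real Set.univ + 2 * M * ∫ x, ‖k • σ x - w x‖ ∂l)) / k := by
              gcongr
          _ = ∫ x, (f x (k • σ x) - ((M + ε) + 2 * M * ‖k • σ x - w x‖)) / k ∂l := by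
              rw [integral_div, integral_sub ifσ i3,
                integral_add (integrable_const _) (i1.const_mul _), integral_const_mul,
                integral_const, smul_eq_mul, mul_comm (l.real Set.univ)]
          _ ≤ _ := by
              refine integral_mono (i2.div_const k)
                (integrable_inner_of_bounded b.continuous (fun x => (hb x).1) hσ) fun x => ?_
              simp only
              rw [div_le_iff₀ hk, mul_comm (inner ℝ (b x) (σ x)), ← real_inner_smul_right]
              have h1 := hlip x (k • σ x) (w x)
              have h2 := (abs_le.1 (hin x (k • σ x - w x))).1
              -- The minorant at `z = 0` bounds `f (x, w x)` by `⟨b x, w x⟩` up to a constant.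
              have h3 := (hb x).2 0
              have h4 := hg x 0
              rw [zero_sub, inner_neg_right] at h3
              rw [norm_zero] at h3 h4
              rw [inner_sub_right] at h2
              linarith
    have hlim : Tendsto (fun ε : ℝ => ∫ x, f x (ρ x) ∂m - 2 * M * ε
        + (∫ x, f x (k • σ x) ∂l - ((M + ε) * l.real Set.univ + 2 * M * ε)) / k)
        (𝓝[>] 0) (𝓝 (∫ x, f x (ρ x) ∂m - 2 * M * 0
        + (∫ x, f x (k • σ x) ∂l - ((M + 0) * l.real Set.univ + 2 * M * 0)) / k)) := by
      refine Tendsto.mono_left (Continuous.tendsto ?_ _) nhdsWithin_le_nhds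
      fun_prop
    have hlim2 : Tendsto (fun ε : ℝ => c + ε * (m.real Set.univ + C)) (𝓝[>] 0)
        (𝓝 (c + 0 * (m.real Set.univ + C))) := by
      refine Tendsto.mono_left (Continuous.tendsto ?_ _) nhdsWithin_le_nhds
      fun_prop
    have h := le_of_tendsto_of_tendsto hlim hlim2 (by
      filter_upwards [self_mem_nhdsWithin] with ε hε using bound ε hε)
    simp only [mul_zero, sub_zero, add_zero, zero_mul, sub_div] at h
    linarith
  have hlimσ : Tendsto (fun k : ℝ => (∫ x, f x (k • σ x) ∂l) / k) atTop
      (𝓝 (∫ x, r x (σ x) ∂l)) := by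
    simp only [← integral_div]
    refine tendsto_integral_filter_of_dominated_convergence (fun x => M * (1 + ‖σ x‖)) ?_ ?_
      (((integrable_const (1 : ℝ)).add hσ.norm).const_mul M)
      (Eventually.of_forall fun x => hr x (σ x))
    · exact Eventually.of_forall fun k =>
        ((integrable_comp_of_linear_growth hf habs (hσ.smul k)).div_const k).aestronglyMeasurable
    · filter_upwards [eventually_ge_atTop 1] with k hk
      refine Eventually.of_forall fun x => ?_
      have hk0 : 0 < k := by linarith
      rw [Real.norm_eq_abs, abs_div, abs_of_pos hk0, div_le_iff₀ hk0]
      refine (habs _ _).trans ?_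
      rw [norm_smul, Real.norm_of_nonneg hk0.le]
      have : 1 + k * ‖σ x‖ ≤ (1 + ‖σ x‖) * k := by nlinarith [norm_nonneg (σ x)]
      calc M * (1 + k * ‖σ x‖) ≤ M * ((1 + ‖σ x‖) * k) := by gcongr
        _ = _ := by ring
  have hlim := hlimσ.const_add (∫ x, f x (ρ x) ∂m)
  have hlim2 : Tendsto (fun k : ℝ => c + M * l.real Set.univ / k) atTop (𝓝 (c + 0)) :=
    (tendsto_const_nhds.div_atTop tendsto_id).const_add c
  rw [add_zero] at hlim2
  exact le_of_tendsto_of_tendsto hlim hlim2 (by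
    filter_upwards [eventually_gt_atTop 0] with k hk using main k hk)

end LowerSemicontinuity

/-! ### The area integrand -/

section Area

variable {E : Type*} [NormedAddCommGroup E] [InnerProductSpace ℝ E]

/-- The area integrand `√(1 + |z|²)`. -/
noncomputable def areaIntegrand (z : E) : ℝ := Real.sqrt (1 + ‖z‖ ^ 2)

/-- The `E`-component of the unit vector `(1, z) / |(1, z)|`, a point of the open unit ball. -/
noncomputable def toBall (z : E) : E := (areaIntegrand z)⁻¹ • z

/-- `|(1, z)| - ν · (1, z)` for the unit vector `ν = (1, w) / |(1, w)|`: the gap between the area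
integrand at `z` and its tangent at `w`. It measures how far the directions of `(1, z)` and
`(1, w)` are apart. -/
noncomputable def areaExcess (w z : E) : ℝ :=
  areaIntegrand z - ((areaIntegrand w)⁻¹ + inner ℝ (toBall w) z)

omit [InnerProductSpace ℝ E] in
theorem sq_areaIntegrand (z : E) : areaIntegrand z ^ 2 = 1 + ‖z‖ ^ 2 :=
  Real.sq_sqrt (by positivity)

omit [InnerProductSpace ℝ E] in
theorem one_le_areaIntegrand (z : E) : 1 ≤ areaIntegrand z :=
  Real.one_le_sqrt.2 (by nlinarith [sq_nonneg ‖z‖])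

omit [InnerProductSpace ℝ E] in
theorem areaIntegrand_pos (z : E) : 0 < areaIntegrand z :=
  zero_lt_one.trans_le (one_le_areaIntegrand z)

omit [InnerProductSpace ℝ E] in
theorem norm_le_areaIntegrand (z : E) : ‖z‖ ≤ areaIntegrand z :=
  Real.le_sqrt_of_sq_le (by linarith)

omit [InnerProductSpace ℝ E] in
theorem areaIntegrand_le (z : E) : areaIntegrand z ≤ 1 + ‖z‖ :=
  Real.sqrt_le_iff.2 ⟨by positivity, by nlinarith [norm_nonneg z]⟩

omit [InnerProductSpace ℝ E] in
theorem areaIntegrand_le_add_norm_sub (z w : E) :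
    areaIntegrand w ≤ areaIntegrand z + ‖z - w‖ := by
  refine Real.sqrt_le_iff.2 ⟨add_nonneg (areaIntegrand_pos z).le (norm_nonneg _), ?_⟩
  have h1 := sq_areaIntegrand z
  have h2 := norm_le_areaIntegrand z
  have h3 : ‖w‖ ≤ ‖z‖ + ‖z - w‖ := by
    have := norm_sub_le z (z - w)
    simpa using this
  nlinarith [norm_nonneg (z - w), norm_nonneg w,
    mul_le_mul_of_nonneg_right h2 (norm_nonneg (z - w))]

omit [InnerProductSpace ℝ E] in
@[fun_prop]
theorem continuous_areaIntegrand : Continuous (areaIntegrand : E → ℝ) := by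
  unfold areaIntegrand
  fun_prop

@[fun_prop]
theorem continuous_toBall : Continuous (toBall : E → E) :=
  (continuous_areaIntegrand.inv₀ fun z => (areaIntegrand_pos z).ne').smul continuous_id

@[simp]
theorem toBall_zero : toBall (0 : E) = 0 := smul_zero _

theorem norm_sq_toBall (z : E) : ‖toBall z‖ ^ 2 = 1 - (areaIntegrand z)⁻¹ ^ 2 := by
  have h1 := sq_areaIntegrand z
  have h2 := areaIntegrand_pos z
  rw [toBall, norm_smul, mul_pow, norm_inv, Real.norm_of_nonneg h2.le]
  field_simp
  linarith

theorem norm_toBall_le_one (z : E) : ‖toBall z‖ ≤ 1 := by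
  have h := norm_sq_toBall z
  have : 0 ≤ (areaIntegrand z)⁻¹ ^ 2 := by positivity
  nlinarith [norm_nonneg (toBall z)]

theorem areaIntegrand_smul_toBall (z : E) : areaIntegrand z • toBall z = z := by
  rw [toBall, smul_smul, mul_inv_cancel₀ (areaIntegrand_pos z).ne', one_smul]

theorem areaExcess_le (w z : E) : areaExcess w z ≤ 2 * ‖z - w‖ := by
  have hw := areaIntegrand_pos w
  have h1 := areaIntegrand_le_add_norm_sub w z
  rw [norm_sub_rev] at h1
  have h2 : (areaIntegrand w)⁻¹ + inner ℝ (toBall w) w = areaIntegrand w := by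
    rw [toBall, real_inner_smul_left, real_inner_self_eq_norm_sq]
    have := sq_areaIntegrand w
    field_simp
    linarith
  have h3 := (abs_le.1 (abs_real_inner_le_norm (toBall w) (z - w))).1
  have h4 := mul_le_of_le_one_left (norm_nonneg (z - w)) (norm_toBall_le_one w)
  rw [inner_sub_right] at h3
  unfold areaExcess
  linarith

/-- The excess controls the squared distance of the directions of `(1, z)` and `(1, w)`. -/
theorem areaIntegrand_mul_norm_sq_sub_le (w z : E) :
    areaIntegrand z * ‖toBall z - toBall w‖ ^ 2 ≤ 2 * areaExcess w z := by
  have hz := areaIntegrand_pos z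
  rw [norm_sub_sq_real, norm_sq_toBall, norm_sq_toBall]
  have h1 : areaIntegrand z * inner ℝ (toBall z) (toBall w) = inner ℝ (toBall w) z := by
    rw [← real_inner_smul_left, areaIntegrand_smul_toBall, real_inner_comm]
  have h2 : areaIntegrand z * (areaIntegrand z)⁻¹ = 1 := mul_inv_cancel₀ hz.ne'
  unfold areaExcess
  set a := (areaIntegrand z)⁻¹
  set b := (areaIntegrand w)⁻¹
  have h3 : 0 ≤ areaIntegrand z * (a - b) ^ 2 := by positivity
  have h4 : areaIntegrand z * (a * b) = b := by rw [← mul_assoc, h2, one_mul]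
  nlinarith

theorem areaExcess_nonneg (w z : E) : 0 ≤ areaExcess w z := by
  have h := areaIntegrand_mul_norm_sq_sub_le w z
  have : 0 ≤ areaIntegrand z * ‖toBall z - toBall w‖ ^ 2 :=
    mul_nonneg (areaIntegrand_pos z).le (sq_nonneg _)
  linarith

theorem norm_sq_sub_toBall_le (w : E) {σ : E} (hσ : ‖σ‖ = 1) :
    ‖σ - toBall w‖ ^ 2 ≤ 2 * (1 - inner ℝ (toBall w) σ) := by
  have h := norm_toBall_le_one w
  rw [norm_sub_sq_real, hσ, real_inner_comm]
  nlinarith [norm_nonneg (toBall w)]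

/-- A vector `w` near a large multiple `k σ` of a unit vector has nearly the direction `(0, σ)`. -/
theorem one_sub_inner_toBall_le (w : E) {σ : E} (hσ : ‖σ‖ = 1) {k : ℝ} (hk : 0 < k) :
    1 - inner ℝ (toBall w) σ ≤ (1 + 2 * ‖k • σ - w‖) / k := by
  have hw := areaIntegrand_pos w
  have h1 : inner ℝ (toBall w) w = areaIntegrand w - (areaIntegrand w)⁻¹ := by
    rw [toBall, real_inner_smul_left, real_inner_self_eq_norm_sq]
    have := sq_areaIntegrand w
    field_simp
    linarith
  have h2 := (abs_le.1 (abs_real_inner_le_norm (toBall w) (k • σ - w))).1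
  have h3 := mul_le_of_le_one_left (norm_nonneg (k • σ - w)) (norm_toBall_le_one w)
  have h4 : (areaIntegrand w)⁻¹ ≤ 1 := inv_le_one_of_one_le₀ (one_le_areaIntegrand w)
  have h5 := norm_le_areaIntegrand w
  have h6 : k ≤ ‖w‖ + ‖k • σ - w‖ := by
    have := norm_add_le w (k • σ - w)
    rwa [add_sub_cancel, norm_smul, hσ, mul_one, Real.norm_of_nonneg hk.le] at this
  rw [inner_sub_right, real_inner_smul_right] at h2
  rw [le_div_iff₀ hk]
  linarith

end Area

/-! ### Continuity of integrals along area-strictly convergent sequences -/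

section Reshetnyak

variable {X E : Type*} [PseudoMetricSpace X] [LocallyCompactSpace X] [SecondCountableTopology X]
  [MeasurableSpace X] [BorelSpace X]
  [NormedAddCommGroup E] [InnerProductSpace ℝ E]
  {m l : Measure X} [IsFiniteMeasure m] [IsFiniteMeasure l]

omit [LocallyCompactSpace X] [InnerProductSpace ℝ E] in
theorem integrable_areaIntegrand {u : X → E} (hu : Integrable u m) :
    Integrable (fun x => areaIntegrand (u x)) m :=
  integrable_comp_of_linear_growth (f := fun _ z => areaIntegrand z) (by fun_prop) (C := 1)
    (fun _ z => by rw [abs_of_pos (areaIntegrand_pos z), one_mul]; exact areaIntegrand_le z) hu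

omit [LocallyCompactSpace X] in
theorem integrable_tangent {c : X → ℝ} (hc : Continuous c) {C : ℝ} (hC : ∀ x, |c x| ≤ C)
    {w : X → E} (hw : Continuous w) {u : X → E} (hu : Integrable u m) :
    Integrable (fun x => c x * ((areaIntegrand (w x))⁻¹ + inner ℝ (toBall (w x)) (u x))) m := by
  refine Integrable.bdd_mul (c := C) (Integrable.add ?_ ?_) hc.aestronglyMeasurable
    (Eventually.of_forall hC)
  · refine Integrable.of_bound (Continuous.aestronglyMeasurable ?_) 1
      (Eventually.of_forall fun x => ?_)
    · exact (continuous_areaIntegrand.comp hw).inv₀ fun x => (areaIntegrand_pos _).ne'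
    · rw [norm_inv, Real.norm_of_nonneg (areaIntegrand_pos _).le]
      exact inv_le_one_of_one_le₀ (one_le_areaIntegrand _)
  · exact integrable_inner_of_bounded (by fun_prop) (fun x => norm_toBall_le_one _) hu

omit [LocallyCompactSpace X] [IsFiniteMeasure m] in
theorem integrable_mul_inner_toBall {c : X → ℝ} (hc : Continuous c) {C : ℝ} (hC : ∀ x, |c x| ≤ C)
    {w : X → E} (hw : Continuous w) {u : X → E} (hu : Integrable u m) :
    Integrable (fun x => c x * inner ℝ (toBall (w x)) (u x)) m :=
  Integrable.bdd_mul (c := C)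
    (integrable_inner_of_bounded (by fun_prop) (fun x => norm_toBall_le_one _) hu)
    hc.aestronglyMeasurable (Eventually.of_forall hC)

omit [LocallyCompactSpace X] [IsFiniteMeasure l] in
/-- The tangents of the area integrand along `w` are affine, with compactly supported slope, so
their integrals pass to the limit. -/
theorem tendsto_integral_tangent {v : ℕ → X → E} {ρ σ : X → E} (hv : ∀ j, Integrable (v j) m)
    (hρ : Integrable ρ m) (hconv : VagueTendsto m l v ρ σ) {w : X → E} (hw : Continuous w)
    (hws : HasCompactSupport w) {c : X → ℝ} (hc : Continuous c) {C : ℝ} (hC : ∀ x, |c x| ≤ C) :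
    Tendsto (fun j => ∫ x, c x * ((areaIntegrand (w x))⁻¹ + inner ℝ (toBall (w x)) (v j x)) ∂m)
      atTop (𝓝 (∫ x, c x * ((areaIntegrand (w x))⁻¹ + inner ℝ (toBall (w x)) (ρ x)) ∂m
        + ∫ x, c x * inner ℝ (toBall (w x)) (σ x) ∂l)) := by
  have i0 : Integrable (fun x => c x * (areaIntegrand (w x))⁻¹) m := by
    have := integrable_tangent (m := m) hc hC hw (integrable_zero X E m)
    simpa using this
  have split : ∀ u : X → E, Integrable u m →
      ∫ x, c x * ((areaIntegrand (w x))⁻¹ + inner ℝ (toBall (w x)) (u x)) ∂m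
        = ∫ x, c x * (areaIntegrand (w x))⁻¹ ∂m + ∫ x, inner ℝ (c x • toBall (w x)) (u x) ∂m := by
    intro u hu
    simp only [real_inner_smul_left]
    rw [← integral_add i0 (integrable_mul_inner_toBall hc hC hw hu)]
    simp only [mul_add]
  have h := (hconv (fun x => c x • toBall (w x)) (by fun_prop)
    ((hws.comp_left toBall_zero).smul_left)).const_add (∫ x, c x * (areaIntegrand (w x))⁻¹ ∂m)
  rw [← add_assoc, ← split ρ hρ] at h
  simp only [← split _ (hv _)] at h
  simpa only [real_inner_smul_left] using h

/-- A compactly supported continuous `w` can be chosen so that the directions `(1, w)` approximate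
the polar vector of `(m, ρ m + σ l)`: take `w` near `ρ` in `L¹(m)` and near `k σ` in `L¹(l)` for a
large `k`. -/
theorem exists_small_excess (hml : l ⟂ₘ m) {ρ σ : X → E} (hρ : Integrable ρ m)
    (hσ : Integrable σ l) (hσ1 : ∀ᵐ x ∂l, ‖σ x‖ = 1) {ε : ℝ} (hε : 0 < ε) :
    ∃ w : X → E, Continuous w ∧ HasCompactSupport w ∧
      ∫ x, areaExcess (w x) (ρ x) ∂m + ∫ x, (1 - inner ℝ (toBall (w x)) (σ x)) ∂l ≤ ε := by
  -- The bound of `one_sub_inner_toBall_le` contributes `l(X) / k`, here at most `ε / 2`.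
  set k : ℝ := 2 * l.real Set.univ / ε + 1 with hk
  have hk1 : 1 ≤ k := by
    have : 0 ≤ 2 * l.real Set.univ / ε := by positivity
    linarith
  have hk0 : 0 < k := by linarith
  obtain ⟨w, hw, hws, hwm, hwl, hw1, hw2⟩ :=
    exists_continuous_approx_pair hml hρ (hσ.smul k) (δ := ε / 8) (by positivity)
  refine ⟨w, hw, hws, ?_⟩
  have i1 : Integrable (fun x => ‖ρ x - w x‖) m := (hρ.sub hwm).norm
  have i2 : Integrable (fun x => ‖k • σ x - w x‖) l := ((hσ.smul k).sub hwl).norm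
  have hw2' : ∫ x, ‖k • σ x - w x‖ ∂l ≤ ε / 8 := hw2
  have h1 : ∫ x, areaExcess (w x) (ρ x) ∂m ≤ 2 * (ε / 8) := by
    calc ∫ x, areaExcess (w x) (ρ x) ∂m ≤ ∫ x, 2 * ‖ρ x - w x‖ ∂m :=
          integral_mono_of_nonneg (Eventually.of_forall fun x => areaExcess_nonneg _ _)
            (i1.const_mul 2) (Eventually.of_forall fun x => areaExcess_le _ _)
      _ ≤ 2 * (ε / 8) := by rw [integral_const_mul]; gcongr
  have h2 : ∫ x, (1 - inner ℝ (toBall (w x)) (σ x)) ∂l ≤ (l.real Set.univ + 2 * (ε / 8)) / k := by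
    calc ∫ x, (1 - inner ℝ (toBall (w x)) (σ x)) ∂l ≤ ∫ x, (1 + 2 * ‖k • σ x - w x‖) / k ∂l := by
          refine integral_mono_of_nonneg ?_
            (((integrable_const (1 : ℝ)).add (i2.const_mul 2)).div_const k) ?_
          · filter_upwards [hσ1] with x hx
            have := norm_sq_sub_toBall_le (w x) hx
            have h3 := sq_nonneg ‖σ x - toBall (w x)‖
            simp only [Pi.zero_apply]
            linarith
          · filter_upwards [hσ1] with x hx using one_sub_inner_toBall_le (w x) hx hk0
      _ = (l.real Set.univ + 2 * ∫ x, ‖k • σ x - w x‖ ∂l) / k := by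
          rw [integral_div, integral_add (integrable_const _) (i2.const_mul 2), integral_const_mul]
          simp
      _ ≤ _ := by gcongr
  have h3 : (l.real Set.univ + 2 * (ε / 8)) / k ≤ ε / 2 + 2 * (ε / 8) := by
    have h4 : l.real Set.univ = ε / 2 * (k - 1) := by
      rw [hk]
      field_simp
      ring
    rw [div_le_iff₀ hk0, h4]
    nlinarith
  linarith

/-- Convergence for integrands `|(1, z)| h (x, z / |(1, z)|)` with `h` uniformly continuous in its
second variable: replacing the direction of `v_j` by that of `w` makes the integrand affine in
`v_j`, at a cost controlled by the excess, whose integral converges to a small number. -/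
theorem tendsto_integral_of_uniform (hml : l ⟂ₘ m) {v : ℕ → X → E} {ρ σ : X → E}
    (hv : ∀ j, Integrable (v j) m) (hρ : Integrable ρ m) (hσ : Integrable σ l)
    (hσ1 : ∀ᵐ x ∂l, ‖σ x‖ = 1) (hconv : VagueTendsto m l v ρ σ)
    (harea : Tendsto (fun j => ∫ x, areaIntegrand (v j x) ∂m) atTop
      (𝓝 (∫ x, areaIntegrand (ρ x) ∂m + l.real Set.univ)))
    {h : X → E → ℝ} (hh : Continuous fun q : X × E => h q.1 q.2) {C : ℝ} (hC0 : 0 ≤ C)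
    (hC : ∀ x N, ‖N‖ ≤ 1 → |h x N| ≤ C)
    (hunif : ∀ η > 0, ∃ K, 0 ≤ K ∧ ∀ x N N', ‖N‖ ≤ 1 → ‖N'‖ ≤ 1 →
      |h x N - h x N'| ≤ η + K * ‖N - N'‖ ^ 2) :
    Tendsto (fun j => ∫ x, areaIntegrand (v j x) * h x (toBall (v j x)) ∂m) atTop
      (𝓝 (∫ x, areaIntegrand (ρ x) * h x (toBall (ρ x)) ∂m + ∫ x, h x (σ x) ∂l)) := by
  have ih : ∀ {u : X → E}, Integrable u m →
      Integrable (fun x => areaIntegrand (u x) * h x (toBall (u x))) m := by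
    intro u hu
    refine integrable_comp_of_linear_growth (f := fun x z => areaIntegrand z * h x (toBall z))
      ?_ (C := C) (fun x z => ?_) hu
    · exact (by fun_prop : Continuous fun q : X × E => areaIntegrand q.2).mul
        (hh.comp (by fun_prop : Continuous fun q : X × E => (q.1, toBall q.2)))
    · rw [abs_mul, abs_of_pos (areaIntegrand_pos z), mul_comm]
      exact mul_le_mul (hC _ _ (norm_toBall_le_one z)) (areaIntegrand_le z)
        (areaIntegrand_pos z).le hC0
  have ihσ : Integrable (fun x => h x (σ x)) l := by
    refine Integrable.of_bound (hh.comp_aestronglyMeasurable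
      (continuous_id.aestronglyMeasurable.prodMk hσ.aestronglyMeasurable)) C ?_
    filter_upwards [hσ1] with x hx using hC _ _ hx.le
  set A : ℝ := ∫ x, areaIntegrand (ρ x) ∂m + l.real Set.univ with hA
  have hA0 : 0 ≤ A :=
    add_nonneg (integral_nonneg fun x => (areaIntegrand_pos _).le) measureReal_nonneg
  rw [Metric.tendsto_atTop']
  intro ε₀ hε₀
  obtain ⟨K, hK0, hK⟩ := hunif (ε₀ / (8 * (A + 1))) (by positivity)
  set η := ε₀ / (8 * (A + 1)) with hη
  have hη0 : 0 < η := by positivity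
  have hηA : η * (A + 1) = ε₀ / 8 := by rw [hη]; field_simp
  set Q : ℝ := 2 * K + C with hQ
  have hQ0 : 0 ≤ Q := by positivity
  set ε := ε₀ / (16 * (Q + 1)) with hε
  have hε1 : 0 < ε := by positivity
  have hεQ : Q * ε ≤ ε₀ / 16 := by
    have : (Q + 1) * ε = ε₀ / 16 := by rw [hε]; field_simp
    linarith
  obtain ⟨w, hw, hws, hwε⟩ := exists_small_excess hml hρ hσ hσ1 hε1
  -- `c` is `h` with the direction frozen to that of `w`; this makes the integrand affine.
  set c : X → ℝ := fun x => h x (toBall (w x)) with hc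
  have hcc : Continuous c := hh.comp (by fun_prop : Continuous fun x : X => (x, toBall (w x)))
  have hcC : ∀ x, |c x| ≤ C := fun x => hC _ _ (norm_toBall_le_one _)
  have iexc : ∀ {u : X → E}, Integrable u m → Integrable (fun x => areaExcess (w x) (u x)) m := by
    intro u hu
    have := (integrable_areaIntegrand hu).sub
      (integrable_tangent (c := fun _ => (1 : ℝ)) continuous_const (C := 1) (by simp) hw hu)
    simpa [areaExcess] using! this
  have iexcσ : Integrable (fun x => 1 - inner ℝ (toBall (w x)) (σ x)) l :=
    (integrable_const _).sub
      (integrable_inner_of_bounded (by fun_prop) (fun x => norm_toBall_le_one _) hσ)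
  have est : ∀ {u : X → E}, Integrable u m →
      |∫ x, areaIntegrand (u x) * h x (toBall (u x)) ∂m
        - ∫ x, c x * ((areaIntegrand (w x))⁻¹ + inner ℝ (toBall (w x)) (u x)) ∂m|
      ≤ η * ∫ x, areaIntegrand (u x) ∂m + Q * ∫ x, areaExcess (w x) (u x) ∂m := by
    intro u hu
    rw [← integral_sub (ih hu) (integrable_tangent hcc hcC hw hu), ← integral_const_mul,
      ← integral_const_mul,
      ← integral_add ((integrable_areaIntegrand hu).const_mul η) ((iexc hu).const_mul Q)]
    refine abs_integral_le_integral_abs.trans (integral_mono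
      ((ih hu).sub (integrable_tangent hcc hcC hw hu)).abs
      (((integrable_areaIntegrand hu).const_mul η).add ((iexc hu).const_mul Q)) fun x => ?_)
    have e : areaIntegrand (u x) * h x (toBall (u x))
        - c x * ((areaIntegrand (w x))⁻¹ + inner ℝ (toBall (w x)) (u x))
        = areaIntegrand (u x) * (h x (toBall (u x)) - c x) + c x * areaExcess (w x) (u x) := by
      unfold areaExcess
      ring
    have h1 := hK x _ _ (norm_toBall_le_one (u x)) (norm_toBall_le_one (w x))
    have h2 := areaIntegrand_mul_norm_sq_sub_le (w x) (u x)
    have h3 := areaIntegrand_pos (u x)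
    have h4 := areaExcess_nonneg (w x) (u x)
    have h5 := mul_le_mul_of_nonneg_left h1 h3.le
    have h6 := mul_le_mul_of_nonneg_left h2 hK0
    have h7 := mul_le_mul_of_nonneg_right (hcC x) h4
    simp only [e]
    refine (abs_add_le _ _).trans ?_
    rw [abs_mul, abs_mul, abs_of_pos h3, abs_of_nonneg h4, hQ]
    linarith
  have estσ : |∫ x, h x (σ x) ∂l - ∫ x, c x * inner ℝ (toBall (w x)) (σ x) ∂l|
      ≤ η * l.real Set.univ + Q * ∫ x, (1 - inner ℝ (toBall (w x)) (σ x)) ∂l := by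
    have i1 := integrable_mul_inner_toBall hcc hcC hw hσ
    have e0 : η * l.real Set.univ + Q * ∫ x, (1 - inner ℝ (toBall (w x)) (σ x)) ∂l
        = ∫ x, (η + Q * (1 - inner ℝ (toBall (w x)) (σ x))) ∂l := by
      rw [integral_add (integrable_const _) (iexcσ.const_mul Q), integral_const_mul, integral_const,
        smul_eq_mul, mul_comm η]
    rw [← integral_sub ihσ i1, e0]
    refine abs_integral_le_integral_abs.trans (integral_mono_ae (ihσ.sub i1).abs
      ((integrable_const _).add (iexcσ.const_mul Q)) ?_)
    filter_upwards [hσ1] with x hx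
    have e : h x (σ x) - c x * inner ℝ (toBall (w x)) (σ x)
        = (h x (σ x) - c x) + c x * (1 - inner ℝ (toBall (w x)) (σ x)) := by ring
    have h1 := hK x _ _ hx.le (norm_toBall_le_one (w x))
    have h2 := norm_sq_sub_toBall_le (w x) hx
    have h4 : 0 ≤ 1 - inner ℝ (toBall (w x)) (σ x) := by
      have := sq_nonneg ‖σ x - toBall (w x)‖
      linarith
    have h6 := mul_le_mul_of_nonneg_left h2 hK0
    have h7 := mul_le_mul_of_nonneg_right (hcC x) h4
    simp only [e]
    refine (abs_add_le _ _).trans ?_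
    rw [abs_mul, abs_of_nonneg h4, hQ]
    linarith
  have htan := tendsto_integral_tangent hv hρ hconv hw hws hcc hcC
  have hexc : Tendsto (fun j => ∫ x, areaExcess (w x) (v j x) ∂m) atTop
      (𝓝 (∫ x, areaExcess (w x) (ρ x) ∂m + ∫ x, (1 - inner ℝ (toBall (w x)) (σ x)) ∂l)) := by
    have t1 := harea.sub (tendsto_integral_tangent hv hρ hconv hw hws
      (c := fun _ => 1) continuous_const (C := 1) (by simp))
    have e1 : ∀ {u : X → E}, Integrable u m → ∫ x, areaExcess (w x) (u x) ∂m
        = ∫ x, areaIntegrand (u x) ∂m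
          - ∫ x, 1 * ((areaIntegrand (w x))⁻¹ + inner ℝ (toBall (w x)) (u x)) ∂m := by
      intro u hu
      rw [← integral_sub (integrable_areaIntegrand hu)
        (integrable_tangent (c := fun _ => (1 : ℝ)) continuous_const (C := 1) (by simp) hw hu)]
      simp only [one_mul, areaExcess]
    have e2 : ∫ x, (1 - inner ℝ (toBall (w x)) (σ x)) ∂l
        = l.real Set.univ - ∫ x, 1 * inner ℝ (toBall (w x)) (σ x) ∂l := by
      simp only [one_mul]
      rw [integral_sub (integrable_const _)
        (integrable_inner_of_bounded (by fun_prop) (fun x => norm_toBall_le_one _) hσ)]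
      simp
    simp only [e1 (hv _), e1 hρ, e2]
    convert t1 using 2
    rw [hA]
    ring
  have ev1 := (harea.eventually_lt_const (lt_add_one A))
  have ev2 := (hexc.eventually_lt_const (lt_add_of_le_of_pos hwε hε1))
  have ev3 := Metric.tendsto_nhds.1 htan (ε₀ / 8) (by positivity)
  obtain ⟨j₀, hj₀⟩ := eventually_atTop.1 (ev1.and (ev2.and ev3))
  refine ⟨j₀, fun j hj => ?_⟩
  obtain ⟨a1, a2, a3⟩ := hj₀ j (le_of_lt hj)
  rw [Real.dist_eq] at a3 ⊢
  have b1 := est (hv j)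
  have b2 := est hρ
  have c1 : η * ∫ x, areaIntegrand (v j x) ∂m ≤ ε₀ / 8 := by
    rw [← hηA]; gcongr
  have c2 : Q * ∫ x, areaExcess (w x) (v j x) ∂m ≤ ε₀ / 8 := by
    have : Q * ∫ x, areaExcess (w x) (v j x) ∂m ≤ Q * (ε + ε) := by gcongr
    linarith
  have c3 : η * ∫ x, areaIntegrand (ρ x) ∂m + η * l.real Set.univ ≤ ε₀ / 8 := by
    rw [← hηA, ← mul_add]
    exact mul_le_mul_of_nonneg_left (by linarith) hη0.le
  have c4 : Q * ∫ x, areaExcess (w x) (ρ x) ∂m + Q * ∫ x, (1 - inner ℝ (toBall (w x)) (σ x)) ∂l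
      ≤ ε₀ / 16 := by
    rw [← mul_add]
    exact (mul_le_mul_of_nonneg_left hwε hQ0).trans hεQ
  rw [abs_le] at b1 b2 estσ
  rw [abs_lt] at a3 ⊢
  constructor <;> linarith

/-- Convergence for integrands `|(1, z)| h (x, z / |(1, z)|)` with `h` merely continuous and bounded
on the unit ball: a cut-off in `x` makes `h` uniformly continuous, and the remaining integrand
`1 - χ (x)` shows that no mass escapes to the boundary. -/
theorem tendsto_integral_of_continuous (hml : l ⟂ₘ m) {v : ℕ → X → E} {ρ σ : X → E}
    [FiniteDimensional ℝ E]
    (hv : ∀ j, Integrable (v j) m) (hρ : Integrable ρ m) (hσ : Integrable σ l)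
    (hσ1 : ∀ᵐ x ∂l, ‖σ x‖ = 1) (hconv : VagueTendsto m l v ρ σ)
    (harea : Tendsto (fun j => ∫ x, areaIntegrand (v j x) ∂m) atTop
      (𝓝 (∫ x, areaIntegrand (ρ x) ∂m + l.real Set.univ)))
    {h : X → E → ℝ} (hh : Continuous fun q : X × E => h q.1 q.2) {C : ℝ} (hC0 : 0 ≤ C)
    (hC : ∀ x N, ‖N‖ ≤ 1 → |h x N| ≤ C) :
    Tendsto (fun j => ∫ x, areaIntegrand (v j x) * h x (toBall (v j x)) ∂m) atTop
      (𝓝 (∫ x, areaIntegrand (ρ x) * h x (toBall (ρ x)) ∂m + ∫ x, h x (σ x) ∂l)) := by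
  have ihσ : Integrable (fun x => h x (σ x)) l := by
    refine Integrable.of_bound (hh.comp_aestronglyMeasurable
      (continuous_id.aestronglyMeasurable.prodMk hσ.aestronglyMeasurable)) C ?_
    filter_upwards [hσ1] with x hx using hC _ _ hx.le
  have ih : ∀ {u : X → E}, Integrable u m →
      Integrable (fun x => areaIntegrand (u x) * h x (toBall (u x))) m := by
    intro u hu
    refine integrable_comp_of_linear_growth (f := fun x z => areaIntegrand z * h x (toBall z))
      ?_ (C := C) (fun x z => ?_) hu
    · exact (by fun_prop : Continuous fun q : X × E => areaIntegrand q.2).mul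
        (hh.comp (by fun_prop : Continuous fun q : X × E => (q.1, toBall q.2)))
    · rw [abs_mul, abs_of_pos (areaIntegrand_pos z), mul_comm]
      exact mul_le_mul (hC _ _ (norm_toBall_le_one z)) (areaIntegrand_le z)
        (areaIntegrand_pos z).le hC0
  obtain ⟨ψ, hψ, hψs, hψI, hψ1⟩ := exists_seq_cutoff X
  rw [Metric.tendsto_atTop']
  intro ε hε
  have htight := (tendsto_integral_cutoff_mul hψ hψI hψ1 (integrable_areaIntegrand hρ)).add
    (tendsto_integral_cutoff_mul hψ hψI hψ1 (integrable_const (μ := l) (1 : ℝ)))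
  set δ := ε / (4 * (C + 1)) with hδ
  have hδ0 : 0 < δ := by positivity
  have hCδ : C * δ ≤ ε / 4 := by
    have : (C + 1) * δ = ε / 4 := by rw [hδ]; field_simp
    linarith
  obtain ⟨n, hn⟩ := (htight.eventually_const_lt (sub_lt_self _ hδ0)).exists
  set χ := ψ n with hχ
  have hχI : ∀ x, χ x ∈ Set.Icc (0 : ℝ) 1 := hψI n
  have hχc : Continuous χ := hψ n
  have imul : ∀ {ν : Measure X} {g : X → ℝ}, Integrable g ν →
      Integrable (fun x => χ x * g x) ν := fun {ν g} hg =>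
    hg.bdd_mul hχc.aestronglyMeasurable (c := 1) (Eventually.of_forall fun x => by
      rw [Real.norm_of_nonneg (hχI x).1]; exact (hχI x).2)
  have imul' : ∀ {ν : Measure X} {g : X → ℝ}, Integrable g ν →
      Integrable (fun x => (1 - χ x) * g x) ν := fun {ν g} hg => by
    simpa only [sub_mul, one_mul] using! hg.sub (imul hg)
  have hin := tendsto_integral_of_uniform hml hv hρ hσ hσ1 hconv harea
    (h := fun x N => χ x * h x N) ((hχc.comp continuous_fst).mul hh) hC0
    (fun x N hN => by
      rw [abs_mul, abs_of_nonneg (hχI x).1]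
      exact (mul_le_of_le_one_left (abs_nonneg _) (hχI x).2).trans (hC x N hN))
    (by
      intro η hη
      have hcomp : IsCompact (tsupport χ ×ˢ Metric.closedBall (0 : E) 1) :=
        (hψs n).isCompact.prod (isCompact_closedBall _ _)
      have huc := hcomp.uniformContinuousOn_of_continuous
        (f := fun q : X × E => χ q.1 * h q.1 q.2)
        ((hχc.comp continuous_fst).mul hh).continuousOn
      obtain ⟨r, hr, hr'⟩ := Metric.uniformContinuousOn_iff.1 huc η hη
      -- Points at distance less than `r` give an error below `η`; beyond `r`, use the bound `C`.
      refine ⟨2 * C / r ^ 2, by positivity, fun x N N' hN hN' => ?_⟩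
      by_cases hx : x ∈ tsupport χ
      · rcases lt_or_ge ‖N - N'‖ r with hlt | hge
        · have := hr' (x, N) ⟨hx, by simpa using hN⟩ (x, N') ⟨hx, by simpa using hN'⟩ (by
            rw [Prod.dist_eq, dist_self, dist_eq_norm]
            exact max_lt hr hlt)
          rw [Real.dist_eq] at this
          have h2 : 0 ≤ 2 * C / r ^ 2 * ‖N - N'‖ ^ 2 := by positivity
          simp only at this ⊢
          linarith
        · have h1 : ∀ N : E, ‖N‖ ≤ 1 → |χ x * h x N| ≤ C := fun N hN => by
            rw [abs_mul, abs_of_nonneg (hχI x).1]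
            exact (mul_le_of_le_one_left (abs_nonneg _) (hχI x).2).trans (hC x N hN)
          have h2 : 2 * C ≤ 2 * C / r ^ 2 * ‖N - N'‖ ^ 2 := by
            rw [div_mul_eq_mul_div, le_div_iff₀ (by positivity)]
            gcongr
          have h3 := abs_sub (χ x * h x N) (χ x * h x N')
          have h4 := h1 N hN
          have h5 := h1 N' hN'
          linarith
      · have : χ x = 0 := image_eq_zero_of_notMem_tsupport hx
        simp only [this, zero_mul, sub_zero, abs_zero]
        positivity)
  have hout := tendsto_integral_of_uniform hml hv hρ hσ hσ1 hconv harea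
    (h := fun x _ => 1 - χ x) ((continuous_const.sub (hχc.comp continuous_fst))) zero_le_one
    (fun x N _ => by
      rw [abs_of_nonneg (by linarith [(hχI x).2])]
      linarith [(hχI x).1])
    (fun η hη => ⟨0, le_rfl, fun x N N' _ _ => by simp [hη.le]⟩)
  have hsmall : ∫ x, areaIntegrand (ρ x) * (1 - χ x) ∂m + ∫ x, (1 - χ x) ∂l < δ := by
    have e1 : ∫ x, areaIntegrand (ρ x) * (1 - χ x) ∂m
        = ∫ x, areaIntegrand (ρ x) ∂m - ∫ x, χ x * areaIntegrand (ρ x) ∂m := by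
      rw [← integral_sub (integrable_areaIntegrand hρ) (imul (integrable_areaIntegrand hρ))]
      refine integral_congr_ae (Eventually.of_forall fun x => ?_)
      simp only
      ring
    have e2 : ∫ x, (1 - χ x) ∂l = ∫ _, (1 : ℝ) ∂l - ∫ x, χ x * 1 ∂l := by
      rw [← integral_sub (integrable_const _) (imul (integrable_const _))]
      simp only [mul_one]
    rw [e1, e2]
    linarith
  have splitm : ∀ {u : X → E}, Integrable u m →
      |∫ x, areaIntegrand (u x) * h x (toBall (u x)) ∂m
        - ∫ x, areaIntegrand (u x) * (χ x * h x (toBall (u x))) ∂m|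
        ≤ C * ∫ x, areaIntegrand (u x) * (1 - χ x) ∂m := by
    intro u hu
    have i1 : Integrable (fun x => areaIntegrand (u x) * (χ x * h x (toBall (u x)))) m := by
      simpa only [mul_left_comm] using imul (ih hu)
    have i2 : Integrable (fun x => areaIntegrand (u x) * (1 - χ x)) m := by
      simpa only [mul_comm] using imul' (integrable_areaIntegrand hu)
    rw [← integral_sub (ih hu) i1, ← integral_const_mul]
    refine abs_integral_le_integral_abs.trans
      (integral_mono ((ih hu).sub i1).abs (i2.const_mul C) fun x => ?_)
    have e : areaIntegrand (u x) * h x (toBall (u x))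
        - areaIntegrand (u x) * (χ x * h x (toBall (u x)))
        = (areaIntegrand (u x) * (1 - χ x)) * h x (toBall (u x)) := by ring
    have h1 : 0 ≤ areaIntegrand (u x) * (1 - χ x) :=
      mul_nonneg (areaIntegrand_pos _).le (by linarith [(hχI x).2])
    simp only [e]
    rw [abs_mul, abs_of_nonneg h1, mul_comm]
    exact mul_le_mul_of_nonneg_right (hC _ _ (norm_toBall_le_one _)) h1
  have splitl : |∫ x, h x (σ x) ∂l - ∫ x, χ x * h x (σ x) ∂l| ≤ C * ∫ x, (1 - χ x) ∂l := by
    have i2 : Integrable (fun x => 1 - χ x) l := by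
      simpa only [mul_one] using imul' (integrable_const (μ := l) (1 : ℝ))
    rw [← integral_sub ihσ (imul ihσ), ← integral_const_mul]
    refine abs_integral_le_integral_abs.trans
      (integral_mono_ae (ihσ.sub (imul ihσ)).abs (i2.const_mul C) ?_)
    filter_upwards [hσ1] with x hx
    have e : h x (σ x) - χ x * h x (σ x) = (1 - χ x) * h x (σ x) := by ring
    have h1 : 0 ≤ 1 - χ x := by linarith [(hχI x).2]
    simp only [e]
    rw [abs_mul, abs_of_nonneg h1, mul_comm]
    exact mul_le_mul_of_nonneg_right (hC _ _ hx.le) h1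
  have ev1 := Metric.tendsto_nhds.1 hin (ε / 4) (by positivity)
  have ev2 := hout.eventually_lt_const hsmall
  obtain ⟨j₀, hj₀⟩ := eventually_atTop.1 (ev1.and ev2)
  refine ⟨j₀, fun j hj => ?_⟩
  obtain ⟨a1, a2⟩ := hj₀ j (le_of_lt hj)
  rw [Real.dist_eq] at a1 ⊢
  have b1 := splitm (hv j)
  have b2 := splitm hρ
  have c1 : C * ∫ x, areaIntegrand (v j x) * (1 - χ x) ∂m ≤ ε / 4 :=
    (mul_le_mul_of_nonneg_left a2.le hC0).trans hCδ
  have c2 : C * ∫ x, areaIntegrand (ρ x) * (1 - χ x) ∂m + C * ∫ x, (1 - χ x) ∂l ≤ ε / 4 := by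
    rw [← mul_add]
    exact (mul_le_mul_of_nonneg_left hsmall.le hC0).trans hCδ
  rw [abs_le] at b1 b2 splitl
  rw [abs_lt] at a1 ⊢
  constructor <;> linarith

end Reshetnyak

/-! ### The perspective of an integrand -/

section Perspective

variable {X E : Type*} [PseudoMetricSpace X] [NormedAddCommGroup E] [NormedSpace ℝ E]

/-- The perspective `s f (x, z / s)` of `f`, extended to `s ≤ 0` by the recession function `r`. -/
noncomputable def perspective (f r : X → E → ℝ) (x : X) (s : ℝ) (z : E) : ℝ :=
  if 0 < s then s * f x (s⁻¹ • z) else r x z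

theorem tendsto_recession_of_prod {f r : X → E → ℝ}
    (hr : ∀ x z, Tendsto (fun q : X × ℝ => f q.1 (q.2 • z) / q.2) (𝓝 x ×ˢ atTop) (𝓝 (r x z)))
    (x : X) (z : E) : Tendsto (fun t : ℝ => f x (t • z) / t) atTop (𝓝 (r x z)) :=
  (hr x z).comp (tendsto_const_nhds.prodMk tendsto_id)

omit [PseudoMetricSpace X] in
theorem abs_recession_sub_le {f r : X → E → ℝ} {L : ℝ}
    (hlip : ∀ x z w, |f x z - f x w| ≤ L * ‖z - w‖)
    (hr : ∀ x z, Tendsto (fun t : ℝ => f x (t • z) / t) atTop (𝓝 (r x z))) (x : X) (z w : E) :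
    |r x z - r x w| ≤ L * ‖z - w‖ := by
  refine le_of_tendsto ((hr x z).sub (hr x w)).abs ?_
  filter_upwards [eventually_gt_atTop 0] with t ht
  rw [← sub_div, abs_div, abs_of_pos ht, div_le_iff₀ ht]
  refine (hlip _ _ _).trans (le_of_eq ?_)
  rw [← smul_sub, norm_smul, Real.norm_of_nonneg ht.le]
  ring

omit [PseudoMetricSpace X] in
theorem abs_recession_le {f r : X → E → ℝ} {C : ℝ} (hC : ∀ x z, |f x z| ≤ C * (1 + ‖z‖))
    (hr : ∀ x z, Tendsto (fun t : ℝ => f x (t • z) / t) atTop (𝓝 (r x z))) (x : X) (z : E) :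
    |r x z| ≤ C * ‖z‖ := by
  have hlim : Tendsto (fun t : ℝ => C * (1 / t + ‖z‖)) atTop (𝓝 (C * (0 + ‖z‖))) :=
    ((tendsto_const_nhds.div_atTop tendsto_id).add_const _).const_mul C
  rw [zero_add] at hlim
  refine le_of_tendsto_of_tendsto (hr x z).abs hlim ?_
  filter_upwards [eventually_gt_atTop 0] with t ht
  rw [abs_div, abs_of_pos ht, div_le_iff₀ ht]
  refine (hC _ _).trans (le_of_eq ?_)
  rw [norm_smul, Real.norm_of_nonneg ht.le]
  field_simp

/-- The recession limit is locally uniform in `x`, which passes from `f` to `r` itself. -/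
theorem exists_uniform_recession {f r : X → E → ℝ}
    (hr : ∀ x z, Tendsto (fun q : X × ℝ => f q.1 (q.2 • z) / q.2) (𝓝 x ×ˢ atTop) (𝓝 (r x z)))
    (x : X) (z : E) {ε : ℝ} (hε : 0 < ε) :
    ∃ T : ℝ, 0 < T ∧ ∀ᶠ y in 𝓝 x, |r y z - r x z| ≤ ε ∧
      ∀ t, T ≤ t → |f y (t • z) / t - r x z| ≤ ε := by
  obtain ⟨pa, ha, pb, hb, hab⟩ := eventually_prod_iff.1
    (Metric.tendsto_nhds.1 (hr x z) ε hε)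
  obtain ⟨T, hT⟩ := eventually_atTop.1 hb
  refine ⟨max T 1, by positivity, ?_⟩
  filter_upwards [ha] with y hy
  have h : ∀ t, max T 1 ≤ t → |f y (t • z) / t - r x z| ≤ ε := fun t ht => by
    have := hab hy (hT t ((le_max_left _ _).trans ht))
    rw [Real.dist_eq] at this
    exact this.le
  refine ⟨?_, h⟩
  refine le_of_tendsto ((tendsto_recession_of_prod hr y z).sub_const (r x z)).abs ?_
  filter_upwards [eventually_ge_atTop (max T 1)] with t ht using h t ht

/-- The existence of the recession function as a limit in `(x, t)` is what makes the perspective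
continuous up to `s = 0`. -/
theorem continuous_perspective {f r : X → E → ℝ}
    (hf : Continuous fun q : X × E => f q.1 q.2) {L : ℝ}
    (hlip : ∀ x z w, |f x z - f x w| ≤ L * ‖z - w‖)
    (hr : ∀ x z, Tendsto (fun q : X × ℝ => f q.1 (q.2 • z) / q.2) (𝓝 x ×ˢ atTop) (𝓝 (r x z))) :
    Continuous fun q : X × ℝ × E => perspective f r q.1 q.2.1 q.2.2 := by
  have hrlip := abs_recession_sub_le hlip (tendsto_recession_of_prod hr)
  rw [continuous_iff_continuousAt]
  rintro ⟨x, s, z⟩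
  rcases lt_or_ge 0 s with hs | hs
  · have h1 : ContinuousAt (fun q : X × ℝ × E => q.2.1 * f q.1 (q.2.1⁻¹ • q.2.2)) (x, s, z) := by
      refine ContinuousAt.mul (by fun_prop) ?_
      refine hf.continuousAt.comp (f := fun q : X × ℝ × E => (q.1, q.2.1⁻¹ • q.2.2)) ?_
      refine ContinuousAt.prodMk (by fun_prop) (ContinuousAt.smul ?_ (by fun_prop))
      exact ContinuousAt.inv₀ (by fun_prop) hs.ne'
    refine h1.congr ?_
    have h2 : ∀ᶠ q : X × ℝ × E in 𝓝 (x, s, z), 0 < q.2.1 :=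
      (by fun_prop : Continuous fun q : X × ℝ × E => q.2.1).continuousAt.eventually_const_lt hs
    filter_upwards [h2] with q hq
    simp only [perspective, if_pos hq]
  · rw [ContinuousAt, Metric.tendsto_nhds]
    intro ε hε
    obtain ⟨T, hT, hTy⟩ := exists_uniform_recession hr x z (ε := ε / 4) (by positivity)
    have e1 : ∀ᶠ q : X × ℝ × E in 𝓝 (x, s, z), |r q.1 z - r x z| ≤ ε / 4 ∧
        ∀ t, T ≤ t → |f q.1 (t • z) / t - r x z| ≤ ε / 4 :=
      (continuous_fst.tendsto (x, s, z)).eventually hTy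
    have e2 : ∀ᶠ q : X × ℝ × E in 𝓝 (x, s, z), q.2.1 < T⁻¹ :=
      (by fun_prop : Continuous fun q : X × ℝ × E => q.2.1).continuousAt.eventually_lt_const
        (hs.trans_lt (inv_pos.2 hT))
    have e3 : ∀ᶠ q : X × ℝ × E in 𝓝 (x, s, z), L * ‖q.2.2 - z‖ < ε / 4 :=
      (by fun_prop : Continuous fun q : X × ℝ × E =>
        L * ‖q.2.2 - z‖).continuousAt.eventually_lt_const (by simpa using hε)
    filter_upwards [e1, e2, e3] with q h1 h2 h3
    rw [Real.dist_eq]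
    have hx : perspective f r x s z = r x z := if_neg hs.not_gt
    simp only [hx]
    rcases lt_or_ge 0 q.2.1 with hq | hq
    · simp only [perspective, if_pos hq]
      have h4 := h1.2 q.2.1⁻¹ ((le_inv_comm₀ hT hq).2 h2.le)
      rw [div_inv_eq_mul, mul_comm] at h4
      have h5 : |q.2.1 * f q.1 (q.2.1⁻¹ • q.2.2) - q.2.1 * f q.1 (q.2.1⁻¹ • z)|
          ≤ L * ‖q.2.2 - z‖ := by
        rw [← mul_sub, abs_mul, abs_of_pos hq]
        refine (mul_le_mul_of_nonneg_left (hlip _ _ _) hq.le).trans (le_of_eq ?_)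
        rw [← smul_sub, norm_smul, norm_inv, Real.norm_of_nonneg hq.le]
        field_simp
      have h6 := abs_sub_le (q.2.1 * f q.1 (q.2.1⁻¹ • q.2.2)) (q.2.1 * f q.1 (q.2.1⁻¹ • z)) (r x z)
      linarith
    · simp only [perspective, if_neg hq.not_gt]
      have h4 := hrlip q.1 q.2.2 z
      have h5 := abs_sub_le (r q.1 q.2.2) (r q.1 z) (r x z)
      linarith [h1.1]

theorem continuous_recession {f r : X → E → ℝ} (hf : Continuous fun q : X × E => f q.1 q.2) {L : ℝ}
    (hlip : ∀ x z w, |f x z - f x w| ≤ L * ‖z - w‖)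
    (hr : ∀ x z, Tendsto (fun q : X × ℝ => f q.1 (q.2 • z) / q.2) (𝓝 x ×ˢ atTop) (𝓝 (r x z))) :
    Continuous fun q : X × E => r q.1 q.2 := by
  have h := (continuous_perspective hf hlip hr).comp
    (by fun_prop : Continuous fun q : X × E => (q.1, (0 : ℝ), q.2))
  simpa [perspective, Function.comp_def] using h

omit [PseudoMetricSpace X] in
theorem abs_perspective_le {f r : X → E → ℝ} {C : ℝ} (hC0 : 0 ≤ C)
    (hC : ∀ x z, |f x z| ≤ C * (1 + ‖z‖))
    (hr : ∀ x z, Tendsto (fun t : ℝ => f x (t • z) / t) atTop (𝓝 (r x z))) (x : X) (s : ℝ) (z : E) :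
    |perspective f r x s z| ≤ C * (|s| + ‖z‖) := by
  unfold perspective
  split_ifs with hs
  · rw [abs_mul, abs_of_pos hs]
    refine (mul_le_mul_of_nonneg_left (hC _ _) hs.le).trans (le_of_eq ?_)
    rw [norm_smul, norm_inv, Real.norm_of_nonneg hs.le]
    field_simp
  · refine (abs_recession_le hC hr x z).trans ?_
    gcongr
    linarith [abs_nonneg s]

end Perspective

/-! ### Reshetnyak's continuity theorem -/

section Reshetnyak

variable {X E : Type*} [PseudoMetricSpace X] [LocallyCompactSpace X] [SecondCountableTopology X]
  [MeasurableSpace X] [BorelSpace X]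
  [NormedAddCommGroup E] [InnerProductSpace ℝ E] [FiniteDimensional ℝ E]
  {m l : Measure X} [IsFiniteMeasure m] [IsFiniteMeasure l]

/-- Reshetnyak's continuity theorem: along an area-strictly convergent sequence, the integrals of a
continuous Lipschitz integrand with a recession function converge. The perspective on the unit
hemisphere, parametrized by its projection to the unit ball, is the function `h` of
`tendsto_integral_of_continuous`. -/
theorem tendsto_integral_of_areaStrict (hml : l ⟂ₘ m) {v : ℕ → X → E} {ρ σ : X → E}
    (hv : ∀ j, Integrable (v j) m) (hρ : Integrable ρ m) (hσ : Integrable σ l)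
    (hσ1 : ∀ᵐ x ∂l, ‖σ x‖ = 1) (hconv : VagueTendsto m l v ρ σ)
    (harea : Tendsto (fun j => ∫ x, areaIntegrand (v j x) ∂m) atTop
      (𝓝 (∫ x, areaIntegrand (ρ x) ∂m + l.real Set.univ)))
    {f r : X → E → ℝ} (hf : Continuous fun q : X × E => f q.1 q.2) {C : ℝ} (hC0 : 0 ≤ C)
    (hC : ∀ x z, |f x z| ≤ C * (1 + ‖z‖)) {L : ℝ}
    (hlip : ∀ x z w, |f x z - f x w| ≤ L * ‖z - w‖)
    (hr : ∀ x z, Tendsto (fun q : X × ℝ => f q.1 (q.2 • z) / q.2) (𝓝 x ×ˢ atTop) (𝓝 (r x z))) :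
    Tendsto (fun j => ∫ x, f x (v j x) ∂m) atTop
      (𝓝 (∫ x, f x (ρ x) ∂m + ∫ x, r x (σ x) ∂l)) := by
  have hh : Continuous fun q : X × E => perspective f r q.1 (Real.sqrt (1 - ‖q.2‖ ^ 2)) q.2 :=
    (continuous_perspective hf hlip hr).comp
      (by fun_prop : Continuous fun q : X × E => (q.1, Real.sqrt (1 - ‖q.2‖ ^ 2), q.2))
  have key := tendsto_integral_of_continuous hml hv hρ hσ hσ1 hconv harea
    (h := fun x N => perspective f r x (Real.sqrt (1 - ‖N‖ ^ 2)) N) hh (C := C * 2) (by positivity)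
    (fun x N hN => by
      refine (abs_perspective_le hC0 hC (tendsto_recession_of_prod hr) _ _ _).trans ?_
      have h1 : |Real.sqrt (1 - ‖N‖ ^ 2)| ≤ 1 := by
        rw [abs_of_nonneg (Real.sqrt_nonneg _)]
        exact Real.sqrt_le_iff.2 ⟨zero_le_one, by nlinarith [sq_nonneg ‖N‖]⟩
      gcongr
      linarith)
  have e1 : ∀ (x : X) (z : E),
      areaIntegrand z * perspective f r x (Real.sqrt (1 - ‖toBall z‖ ^ 2)) (toBall z) = f x z := by
    intro x z
    have hz := areaIntegrand_pos z
    have h1 : Real.sqrt (1 - ‖toBall z‖ ^ 2) = (areaIntegrand z)⁻¹ := by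
      rw [norm_sq_toBall, sub_sub_cancel, Real.sqrt_sq (inv_pos.2 hz).le]
    rw [h1, perspective, if_pos (inv_pos.2 hz), inv_inv, areaIntegrand_smul_toBall,
      mul_inv_cancel_left₀ hz.ne']
  have e2 : ∫ x, perspective f r x (Real.sqrt (1 - ‖σ x‖ ^ 2)) (σ x) ∂l = ∫ x, r x (σ x) ∂l := by
    refine integral_congr_ae ?_
    filter_upwards [hσ1] with x hx
    simp [perspective, hx]
  simpa only [e1, e2] using key

/-- Reshetnyak's continuity theorem for the translates `u₀ + v_j` by a fixed integrable function.
The integrand `f (x, u₀ x + z)` is not continuous in `x`; approximate `u₀` in `L¹` by compactly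
supported continuous functions, for which it is, and which leave the recession function
unchanged. -/
theorem tendsto_integral_add_of_areaStrict (hml : l ⟂ₘ m) {v : ℕ → X → E} {ρ σ : X → E}
    (hv : ∀ j, Integrable (v j) m) (hρ : Integrable ρ m) (hσ : Integrable σ l)
    (hσ1 : ∀ᵐ x ∂l, ‖σ x‖ = 1) (hconv : VagueTendsto m l v ρ σ)
    (harea : Tendsto (fun j => ∫ x, areaIntegrand (v j x) ∂m) atTop
      (𝓝 (∫ x, areaIntegrand (ρ x) ∂m + l.real Set.univ)))
    {f r : X → E → ℝ} (hf : Continuous fun q : X × E => f q.1 q.2) {C : ℝ} (hC0 : 0 ≤ C)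
    (hC : ∀ x z, |f x z| ≤ C * (1 + ‖z‖)) {L : ℝ} (hL : 0 ≤ L)
    (hlip : ∀ x z w, |f x z - f x w| ≤ L * ‖z - w‖)
    (hr : ∀ x z, Tendsto (fun q : X × ℝ => f q.1 (q.2 • z) / q.2) (𝓝 x ×ˢ atTop) (𝓝 (r x z)))
    {u₀ : X → E} (hu₀ : Integrable u₀ m) :
    Tendsto (fun j => ∫ x, f x (u₀ x + v j x) ∂m) atTop
      (𝓝 (∫ x, f x (u₀ x + ρ x) ∂m + ∫ x, r x (σ x) ∂l)) := by
  rw [Metric.tendsto_atTop']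
  intro ε hε
  set δ := ε / (4 * (L + 1)) with hδ
  have hδ0 : 0 < δ := by positivity
  have hLδ : L * δ ≤ ε / 4 := by
    have : (L + 1) * δ = ε / 4 := by rw [hδ]; field_simp
    linarith
  obtain ⟨w, hws, hw1, hw, hwm⟩ := hu₀.exists_hasCompactSupport_integral_sub_le hδ0
  obtain ⟨B, hB⟩ := hw.bounded_above_of_compact_support hws
  have hconvw := tendsto_integral_of_areaStrict hml hv hρ hσ hσ1 hconv harea
    (f := fun x z => f x (w x + z)) (r := r)
    (hf.comp (by fun_prop : Continuous fun q : X × E => (q.1, w q.1 + q.2)))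
    (C := C * (1 + |B|)) (by positivity)
    (fun x z => by
      refine (hC _ _).trans ?_
      rw [mul_assoc]
      gcongr
      have h1 := norm_add_le (w x) z
      have h2 := (hB x).trans (le_abs_self B)
      nlinarith [norm_nonneg z, abs_nonneg B])
    (fun x z z' => by simpa using hlip x (w x + z) (w x + z'))
    (fun x z => by
      have hdiff : Tendsto (fun q : X × ℝ => (f q.1 (w q.1 + q.2 • z) - f q.1 (q.2 • z)) / q.2)
          (𝓝 x ×ˢ atTop) (𝓝 0) := by
        have hlim : Tendsto (fun q : X × ℝ => L * |B| / q.2) (𝓝 x ×ˢ atTop) (𝓝 0) :=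
          (tendsto_const_nhds.div_atTop tendsto_id).comp tendsto_snd
        refine squeeze_zero_norm' ?_ hlim
        filter_upwards [tendsto_snd.eventually (eventually_gt_atTop (0 : ℝ))] with q hq
        rw [norm_div, Real.norm_of_nonneg hq.le]
        gcongr
        refine (hlip _ _ _).trans ?_
        rw [add_sub_cancel_right]
        gcongr
        exact (hB _).trans (le_abs_self B)
      have h2 := hdiff.add (hr x z)
      rw [zero_add] at h2
      refine h2.congr fun q => ?_
      rw [sub_div, sub_add_cancel])
  have i0 : Integrable (fun x => ‖u₀ x - w x‖) m := (hu₀.sub hwm).norm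
  have est : ∀ {u : X → E}, Integrable u m →
      |∫ x, f x (u₀ x + u x) ∂m - ∫ x, f x (w x + u x) ∂m| ≤ ε / 4 := by
    intro u hu
    have i1 := integrable_comp_of_linear_growth hf hC (hu₀.add hu)
    have i2 := integrable_comp_of_linear_growth hf hC (hwm.add hu)
    rw [← integral_sub (by simpa using! i1) (by simpa using! i2)]
    calc |∫ x, (f x (u₀ x + u x) - f x (w x + u x)) ∂m|
        ≤ ∫ x, |f x (u₀ x + u x) - f x (w x + u x)| ∂m := abs_integral_le_integral_abs
      _ ≤ ∫ x, L * ‖u₀ x - w x‖ ∂m := by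
          refine integral_mono (by simpa using! (i1.sub i2).abs) (i0.const_mul L) fun x => ?_
          simpa using hlip x (u₀ x + u x) (w x + u x)
      _ ≤ L * δ := by rw [integral_const_mul]; gcongr
      _ ≤ ε / 4 := hLδ
  obtain ⟨j₀, hj₀⟩ := eventually_atTop.1 (Metric.tendsto_nhds.1 hconvw (ε / 4) (by positivity))
  refine ⟨j₀, fun j hj => ?_⟩
  have a := hj₀ j (le_of_lt hj)
  rw [Real.dist_eq] at a ⊢
  have b1 := est (hv j)
  have b2 := est hρ
  rw [abs_le] at b1 b2
  rw [abs_lt] at a ⊢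
  constructor <;> linarith

end Reshetnyak

/-! ### Vector measures and their densities -/

section Pairing

variable {X E : Type*} [MeasurableSpace X] [NormedAddCommGroup E] [InnerProductSpace ℝ E]
  [CompleteSpace E]

omit [InnerProductSpace ℝ E] in
theorem isFiniteMeasure_variation_withDensityᵥ [NormedSpace ℝ E] {m : Measure X} {u : X → E}
    (hu : Integrable u m) : IsFiniteMeasure (m.withDensityᵥ u).variation := by
  rw [Measure.variation_withDensityᵥ hu]
  exact isFiniteMeasure_withDensity hu.2.ne

/-- The integral against the vector measure `u m` is the integral of `φ · u` against `m`. -/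
theorem integral_withDensityᵥ_innerSL {m : Measure X} {u φ : X → E} (hu : Integrable u m)
    (hφ : StronglyMeasurable φ) {C : ℝ} (hC : ∀ x, ‖φ x‖ ≤ C) :
    (m.withDensityᵥ u).integral φ (innerSL ℝ) = ∫ x, inner ℝ (φ x) (u x) ∂m := by
  have := isFiniteMeasure_variation_withDensityᵥ hu
  have iin : ∀ g : SimpleFunc X E, Integrable (fun x => inner ℝ (g x) (u x)) m := by
    intro g
    obtain ⟨B, hB⟩ := g.exists_forall_norm_le
    refine (hu.norm.const_mul B).mono'
      (g.stronglyMeasurable.aestronglyMeasurable.inner hu.aestronglyMeasurable)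
      (Eventually.of_forall fun x => ?_)
    exact (norm_inner_le_norm _ _).trans (mul_le_mul_of_nonneg_right (hB x) (norm_nonneg _))
  have simple : ∀ g : SimpleFunc X E,
      (m.withDensityᵥ u).integral g (innerSL ℝ) = ∫ x, inner ℝ (g x) (u x) ∂m := by
    intro g
    induction g using SimpleFunc.induction with
    | const c hs =>
      rename_i s
      have e : ⇑(SimpleFunc.piecewise s hs (SimpleFunc.const X c) (SimpleFunc.const X 0))
          = s.indicator fun _ => c := by
        classical
        rw [SimpleFunc.coe_piecewise, SimpleFunc.coe_const, SimpleFunc.coe_const,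
          ← Set.piecewise_eq_indicator]
        rfl
      rw [e]
      rw [VectorMeasure.integral_indicator_const (μ := m.withDensityᵥ u) (B := innerSL ℝ) c hs,
        withDensityᵥ_apply hu hs, innerSL_apply_apply, ← integral_inner hu.integrableOn,
        ← integral_indicator hs]
      refine integral_congr_ae (Eventually.of_forall fun x => ?_)
      by_cases hx : x ∈ s <;> simp [hx]
    | add hd hf hg =>
      rename_i f g
      rw [SimpleFunc.coe_add, VectorMeasure.integral_add
        (f.integrable_of_isFiniteMeasure) (g.integrable_of_isFiniteMeasure), hf, hg,
        ← integral_add (iin f) (iin g)]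
      simp only [Pi.add_apply, inner_add_left]
  rcases isEmpty_or_nonempty X with hX | ⟨⟨x₀⟩⟩
  · rw [VectorMeasure.integral_of_isEmpty, integral_of_isEmpty]
  have hC0 : 0 ≤ C := (norm_nonneg _).trans (hC x₀)
  have l1 : Tendsto (fun n => (m.withDensityᵥ u).integral (hφ.approxBounded C n) (innerSL ℝ)) atTop
      (𝓝 ((m.withDensityᵥ u).integral φ (innerSL ℝ))) :=
    VectorMeasure.tendsto_integral_of_dominated_convergence (fun _ => C)
      (fun n => (hφ.approxBounded C n).stronglyMeasurable.aestronglyMeasurable) (integrable_const _)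
      (fun n => Eventually.of_forall fun x => hφ.norm_approxBounded_le hC0 n x)
      (Eventually.of_forall fun x => hφ.tendsto_approxBounded_of_norm_le (hC x))
  have l2 : Tendsto (fun n => ∫ x, inner ℝ (hφ.approxBounded C n x) (u x) ∂m) atTop
      (𝓝 (∫ x, inner ℝ (φ x) (u x) ∂m)) := by
    refine tendsto_integral_of_dominated_convergence (fun x => C * ‖u x‖)
      (fun n => (iin _).aestronglyMeasurable) (hu.norm.const_mul C)
      (fun n => Eventually.of_forall fun x => ?_) (Eventually.of_forall fun x => ?_)
    · exact (norm_inner_le_norm _ _).trans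
        (mul_le_mul_of_nonneg_right (hφ.norm_approxBounded_le hC0 n x) (norm_nonneg _))
    · exact (hφ.tendsto_approxBounded_of_norm_le (hC x)).inner tendsto_const_nhds
  simp only [simple] at l1
  exact tendsto_nhds_unique l1 l2

end Pairing

section Decomposition

variable {d N : ℕ} {Ω : Opens (Euc d)}

theorem ext_component {μ ν : VectorMeasure Ω (Euc N)} (h : ∀ i, component μ i = component ν i) :
    μ = ν := by
  refine VectorMeasure.ext fun s _ => ?_
  ext i
  rw [← component_apply, ← component_apply, h i]

theorem component_sub (μ ν : VectorMeasure Ω (Euc N)) (i : Fin N) :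
    component (μ - ν) i = component μ i - component ν i :=
  VectorMeasure.ext fun _ _ => rfl

theorem component_withDensityᵥ {m : Measure Ω} {u : Ω → Euc N} (hu : Integrable u m) (i : Fin N) :
    component (m.withDensityᵥ u) i = m.withDensityᵥ fun x => u x i := by
  refine VectorMeasure.ext fun s hs => ?_
  rw [component_apply, withDensityᵥ_apply hu hs, withDensityᵥ_apply (hu.eval_piLp i) hs]
  exact ((EuclideanSpace.proj (𝕜 := ℝ) i : Euc N →L[ℝ] ℝ).integral_comp_comm hu.integrableOn).symm

theorem variation_le_sum_component (μ : VectorMeasure Ω (Euc N)) :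
    μ.variation ≤ ∑ i, (component μ i).variation := by
  refine VectorMeasure.variation_le_of_forall_enorm_le fun s _ => ?_
  rw [Measure.finsetSum_apply]
  calc ‖μ s‖ₑ = ‖∑ i, EuclideanSpace.single i (μ s i)‖ₑ := by
        congr 1
        ext j
        simp [Finset.sum_apply, Pi.single_apply]
    _ ≤ ∑ i, ‖EuclideanSpace.single i (μ s i)‖ₑ := enorm_sum_le _ _
    _ ≤ ∑ i, (component μ i).variation s := by
        refine Finset.sum_le_sum fun i _ => ?_
        have : ‖EuclideanSpace.single i (μ s i)‖ₑ = ‖component μ i s‖ₑ := by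
          rw [component_apply, ← ofReal_norm, ← ofReal_norm, PiLp.norm_single]
        rw [this]
        exact VectorMeasure.enorm_measure_le_variation _ _

/-- The components of a vector measure in `ℝᴺ` are signed measures, so its variation is finite. -/
instance isFiniteMeasure_variation (μ : VectorMeasure Ω (Euc N)) : IsFiniteMeasure μ.variation := by
  have : ∀ i, IsFiniteMeasure (component μ i).variation := fun i => by
    rw [← SignedMeasure.totalVariation_eq_variation]
    infer_instance
  exact isFiniteMeasure_of_le _ (variation_le_sum_component μ)

theorem integrable_density (μ : VectorMeasure Ω (Euc N)) (m : Measure Ω) :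
    Integrable (density μ m) m :=
  Integrable.of_eval_piLp fun i => SignedMeasure.integrable_rnDeriv (component μ i) m

theorem withDensityᵥ_density (μ : VectorMeasure Ω (Euc N)) {m : Measure Ω} [SigmaFinite m]
    (h : μ.variation ≪ m) : m.withDensityᵥ (density μ m) = μ := by
  refine ext_component fun i => ?_
  rw [component_withDensityᵥ (integrable_density μ m)]
  refine SignedMeasure.withDensityᵥ_rnDeriv_eq (component μ i) m
    (VectorMeasure.AbsolutelyContinuous.mk fun s hs hms => ?_)
  rw [Measure.toENNRealVectorMeasure_apply_measurable hs] at hms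
  have h1 : ‖μ s‖ₑ ≤ 0 := (h hms) ▸ VectorMeasure.enorm_measure_le_variation μ s
  have h2 : μ s = 0 := by simpa using h1
  rw [component_apply, h2]
  rfl

/-- The density of a vector measure with respect to its variation is a unit vector. -/
theorem norm_density_variation (μ : VectorMeasure Ω (Euc N)) :
    ∀ᵐ x ∂μ.variation, ‖density μ μ.variation x‖ = 1 := by
  have hi := integrable_density μ μ.variation
  have h := Measure.variation_withDensityᵥ hi
  rw [withDensityᵥ_density μ Measure.AbsolutelyContinuous.rfl] at h
  have h2 : μ.variation.withDensity (fun x => ‖density μ μ.variation x‖ₑ)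
      = μ.variation.withDensity 1 := by rw [← h, withDensity_one]
  have h3 := (withDensity_eq_iff hi.aestronglyMeasurable.enorm measurable_one.aemeasurable
    hi.2.ne).1 h2
  filter_upwards [h3] with x hx
  rw [← toReal_enorm, hx]
  simp

theorem density_sub_ae (μ ν : VectorMeasure Ω (Euc N)) (m : Measure Ω) [SigmaFinite m] :
    density (μ - ν) m =ᵐ[m] density μ m - density ν m := by
  have h : ∀ᵐ x ∂m, ∀ i, (component (μ - ν) i).rnDeriv m x
      = (component μ i).rnDeriv m x - (component ν i).rnDeriv m x := by
    refine ae_all_iff.2 fun i => ?_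
    rw [component_sub]
    exact SignedMeasure.rnDeriv_sub _ _ m
  filter_upwards [h] with x hx
  ext i
  exact hx i

theorem density_withDensityᵥ_ae {m : Measure Ω} {u : Ω → Euc N} (hu : Integrable u m) :
    density (m.withDensityᵥ u) m =ᵐ[m] u := by
  have h : ∀ᵐ x ∂m, ∀ i, u x i = (component (m.withDensityᵥ u) i).rnDeriv m x := by
    refine ae_all_iff.2 fun i => ?_
    refine SignedMeasure.eq_rnDeriv 0 _ (hu.eval_piLp i)
      VectorMeasure.MutuallySingular.zero_left ?_
    rw [zero_add, component_withDensityᵥ hu]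
  filter_upwards [h] with x hx
  ext i
  exact (hx i).symm

theorem toMeas_congr {u v : Ω → Euc N} (h : u =ᵐ[leb Ω] v) : toMeas u = toMeas v :=
  WithDensityᵥEq.congr_ae h

theorem pairing_toMeas {u φ : Ω → Euc N} (hu : Integrable u (leb Ω)) (hφ : Continuous φ) {C : ℝ}
    (hC : ∀ x, ‖φ x‖ ≤ C) : pairing (toMeas u) φ = ∫ x, inner ℝ (φ x) (u x) ∂(leb Ω) :=
  integral_withDensityᵥ_innerSL hu hφ.stronglyMeasurable hC

theorem singularPart_toMeas {u : Ω → Euc N} (hu : Integrable u (leb Ω)) :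
    singularPart (toMeas u) = 0 := by
  have h : toMeas (density (toMeas u) (leb Ω)) = toMeas u :=
    toMeas_congr (density_withDensityᵥ_ae hu)
  rw [singularPart, h, sub_self]

/-- The pairing with a bounded continuous function, in terms of the densities of the absolutely
continuous and the singular part. -/
theorem pairing_eq_integral_density (μ : VectorMeasure Ω (Euc N)) {φ : Ω → Euc N}
    (hφ : Continuous φ) {C : ℝ} (hC : ∀ x, ‖φ x‖ ≤ C) :
    pairing μ φ = ∫ x, inner ℝ (φ x) (density μ (leb Ω) x) ∂(leb Ω)
      + ∫ x, inner ℝ (φ x) (density (singularPart μ) (singularPart μ).variation x)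
        ∂(singularPart μ).variation := by
  have hint : ∀ ν : VectorMeasure Ω (Euc N), ν.Integrable φ := fun ν =>
    Integrable.of_bound hφ.aestronglyMeasurable C (Eventually.of_forall hC)
  have e1 : pairing μ φ = pairing (toMeas (density μ (leb Ω))) φ + pairing (singularPart μ) φ := by
    unfold pairing
    rw [← VectorMeasure.integral_add_vectorMeasure (hint _) (hint _), singularPart, add_sub_cancel]
  have e2 : pairing (singularPart μ) φ = ∫ x, inner ℝ (φ x)
      (density (singularPart μ) (singularPart μ).variation x) ∂(singularPart μ).variation := by
    have h := integral_withDensityᵥ_innerSL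
      (integrable_density (singularPart μ) (singularPart μ).variation) hφ.stronglyMeasurable hC
    rwa [withDensityᵥ_density _ Measure.AbsolutelyContinuous.rfl] at h
  rw [e1, e2, pairing_toMeas (integrable_density _ _) hφ hC]

variable [IsFiniteMeasure (leb Ω)]

theorem component_singularPart (μ : VectorMeasure Ω (Euc N)) (i : Fin N) :
    component (singularPart μ) i = (component μ i).singularPart (leb Ω) := by
  rw [singularPart, component_sub, toMeas, component_withDensityᵥ (integrable_density _ _)]
  rw [sub_eq_iff_eq_add]
  exact (SignedMeasure.singularPart_add_withDensity_rnDeriv_eq (leb Ω) (component μ i)).symm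

/-- `μˢ` is singular with respect to the Lebesgue measure, since each of its components is. -/
theorem singularPart_mutuallySingular (μ : VectorMeasure Ω (Euc N)) :
    (singularPart μ).variation ⟂ₘ leb Ω := by
  refine Measure.MutuallySingular.mono ?_ (variation_le_sum_component _) le_rfl
  rw [← Measure.sum_fintype, Measure.MutuallySingular.sum_left]
  intro i
  rw [component_singularPart, ← SignedMeasure.totalVariation_eq_variation,
    SignedMeasure.singularPart_totalVariation]
  exact (Measure.mutuallySingular_singularPart _ _).add_left
    (Measure.mutuallySingular_singularPart _ _)

theorem density_sub_toMeas_ae (μ : VectorMeasure Ω (Euc N)) {u : Ω → Euc N}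
    (hu : Integrable u (leb Ω)) :
    density (μ - toMeas u) (leb Ω) =ᵐ[leb Ω] density μ (leb Ω) - u :=
  (density_sub_ae μ _ _).trans ((ae_eq_refl _).sub (density_withDensityᵥ_ae hu))

theorem singularPart_sub_toMeas (μ : VectorMeasure Ω (Euc N)) {u : Ω → Euc N}
    (hu : Integrable u (leb Ω)) : singularPart (μ - toMeas u) = singularPart μ := by
  have h : toMeas (density μ (leb Ω) - u) = toMeas (density μ (leb Ω)) - toMeas u :=
    withDensityᵥ_sub (integrable_density _ _) hu
  rw [singularPart, singularPart, toMeas_congr (density_sub_toMeas_ae μ hu), h]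
  abel

theorem area_toMeas {u : Ω → Euc N} (hu : Integrable u (leb Ω)) :
    area (toMeas u) = ENNReal.ofReal (∫ x, areaIntegrand (u x) ∂(leb Ω)) := by
  rw [area, singularPart_toMeas hu, VectorMeasure.variation_zero, Measure.coe_zero, Pi.zero_apply,
    add_zero, ofReal_integral_eq_lintegral_ofReal (integrable_areaIntegrand hu)
      (Eventually.of_forall fun x => (areaIntegrand_pos _).le)]
  refine lintegral_congr_ae ?_
  filter_upwards [density_withDensityᵥ_ae hu] with x hx
  rw [toMeas, hx]
  rfl

theorem area_eq_ofReal (μ : VectorMeasure Ω (Euc N)) :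
    area μ = ENNReal.ofReal (∫ x, areaIntegrand (density μ (leb Ω) x) ∂(leb Ω)
      + (singularPart μ).variation.real Set.univ) := by
  have hi := integrable_areaIntegrand (integrable_density μ (leb Ω))
  rw [ENNReal.ofReal_add (integral_nonneg fun x => (areaIntegrand_pos _).le) measureReal_nonneg,
    ofReal_measureReal, ofReal_integral_eq_lintegral_ofReal hi
      (Eventually.of_forall fun x => (areaIntegrand_pos _).le)]
  rfl

end Decomposition

/-! ### Relaxation -/

section Relaxation

variable {d N n : ℕ} {Ω : Opens (Euc d)}

theorem isFiniteMeasure_leb (hΩ : volume (Ω : Set (Euc d)) ≠ ∞) : IsFiniteMeasure (leb Ω) := by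
  have h : leb Ω Set.univ = volume ((Subtype.val : Ω → Euc d) '' Set.univ) :=
    (MeasurableEmbedding.subtype_coe Ω.isOpen.measurableSet).comap_apply volume Set.univ
  refine ⟨?_⟩
  rw [h, Set.image_univ, Subtype.range_coe_subtype]
  exact hΩ.lt_top

theorem weakStarTendsto_of_narrowTendsto {μ : ℕ → VectorMeasure Ω (Euc N)}
    {ν : VectorMeasure Ω (Euc N)} (h : NarrowTendsto μ ν) : WeakStarTendsto μ ν :=
  fun φ => h φ.toBCF

theorem relaxation_weakStar_le_narrow (A : LinearPDO Ω N n) (f : Ω → Euc N → ℝ) (u₀ : Ω → Euc N)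
    (μ : VectorMeasure Ω (Euc N)) :
    relaxation WeakStarTendsto A f u₀ μ ≤ relaxation NarrowTendsto A f u₀ μ :=
  le_iInf fun u => le_iInf fun hu => le_iInf fun hc =>
    iInf_le_of_le u (iInf_le_of_le hu (iInf_le_of_le (weakStarTendsto_of_narrowTendsto hc) le_rfl))

/-- Weak* convergence of measures `u_j ℒᵈ`, expressed through the densities of the limit. -/
theorem vagueTendsto_of_weakStarTendsto {u : ℕ → Ω → Euc N} (hu : ∀ j, Integrable (u j) (leb Ω))
    {μ : VectorMeasure Ω (Euc N)} (h : WeakStarTendsto (fun j => toMeas (u j)) μ) :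
    VagueTendsto (leb Ω) (singularPart μ).variation u (density μ (leb Ω))
      (density (singularPart μ) (singularPart μ).variation) := by
  intro φ hφ hsupp
  obtain ⟨C, hC⟩ := hsupp.exists_bound_of_continuous hφ
  have h1 := h ⟨⟨φ, hφ⟩, hsupp.is_zero_at_infty⟩
  rw [← pairing_eq_integral_density μ hφ hC]
  refine h1.congr fun j => ?_
  exact pairing_toMeas (hu j) hφ hC

theorem energy_eq_ofReal {f : Ω → Euc N → ℝ} (h0 : ∀ x z, 0 ≤ f x z) {u : Ω → Euc N}
    (h : Integrable (fun x => f x (u x)) (leb Ω)) :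
    energy f u = ENNReal.ofReal (∫ x, f x (u x) ∂(leb Ω)) :=
  (ofReal_integral_eq_lintegral_ofReal h (Eventually.of_forall fun x => h0 x _)).symm

variable [IsFiniteMeasure (leb Ω)]

theorem relaxedEnergy_eq_ofReal {f : Ω → Euc N → ℝ} (h0 : ∀ x z, 0 ≤ f x z)
    (hf : Continuous fun q : Ω × Euc N => f q.1 q.2) {M : ℝ}
    (hM : ∀ x z, |f x z| ≤ M * (1 + ‖z‖)) {L : ℝ}
    (hlip : ∀ x z w, |f x z - f x w| ≤ L * ‖z - w‖)
    (hr : ∀ x z, Tendsto (fun p : Ω × ℝ => f p.1 (p.2 • z) / p.2) (𝓝 x ×ˢ atTop)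
      (𝓝 (recession f x z))) (μ : VectorMeasure Ω (Euc N)) :
    relaxedEnergy f μ = ENNReal.ofReal (∫ x, f x (density μ (leb Ω) x) ∂(leb Ω)
      + ∫ x, recession f x (density (singularPart μ) (singularPart μ).variation x)
        ∂(singularPart μ).variation) := by
  have hr1 := tendsto_recession_of_prod hr
  have hM0 : ∀ x : Ω, 0 ≤ M := fun x => by simpa using (abs_nonneg _).trans (hM x 0)
  have r0 : ∀ x z, 0 ≤ recession f x z := fun x z =>
    ge_of_tendsto (hr1 x z) ((eventually_ge_atTop 0).mono fun t ht => div_nonneg (h0 _ _) ht)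
  have rM : ∀ x z, |recession f x z| ≤ M * (1 + ‖z‖) := fun x z =>
    (abs_recession_le hM hr1 x z).trans
      (mul_le_mul_of_nonneg_left (le_add_of_nonneg_left zero_le_one) (hM0 x))
  have i1 := integrable_comp_of_linear_growth hf hM (integrable_density μ (leb Ω))
  have i2 := integrable_comp_of_linear_growth (continuous_recession hf hlip hr) rM
    (integrable_density (singularPart μ) (singularPart μ).variation)
  rw [ENNReal.ofReal_add (integral_nonneg fun x => h0 _ _) (integral_nonneg fun x => r0 _ _),
    ofReal_integral_eq_lintegral_ofReal i1 (Eventually.of_forall fun x => h0 _ _),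
    ofReal_integral_eq_lintegral_ofReal i2 (Eventually.of_forall fun x => r0 _ _)]
  rfl

/-- The lower bound. A sequence whose energies have a finite lower limit is, along a subsequence,
bounded in `L¹` by coercivity, so lower semicontinuity applies to it; `𝒜` plays no role. -/
theorem relaxedEnergy_le_relaxation (A : LinearPDO Ω N n) {u₀ : Ω → Euc N}
    (hu₀ : Integrable u₀ (leb Ω)) {f : Ω → Euc N → ℝ}
    (hf : Continuous fun q : Ω × Euc N => f q.1 q.2) (h0 : ∀ x z, 0 ≤ f x z)
    (hconv : ∀ x, ConvexOn ℝ Set.univ (f x)) {M : ℝ} (hM : 0 < M)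
    (hlow : ∀ x z, 1 / M * (‖z‖ - 1) ≤ f x z) (hup : ∀ x z, f x z ≤ M * (1 + ‖z‖))
    (hloc : ∀ x, ∀ η > 0, ∀ᶠ y in 𝓝 x, ∀ z, |f x z - f y z| ≤ η * (1 + ‖z‖))
    (hr : ∀ x z, Tendsto (fun p : Ω × ℝ => f p.1 (p.2 • z) / p.2) (𝓝 x ×ˢ atTop)
      (𝓝 (recession f x z))) (μ : VectorMeasure Ω (Euc N)) :
    relaxedEnergy f μ ≤ relaxation WeakStarTendsto A f u₀ μ := by
  have : LocallyCompactSpace Ω := Ω.isOpen.locallyCompactSpace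
  have habs : ∀ x z, |f x z| ≤ M * (1 + ‖z‖) := fun x z => by
    rw [abs_of_nonneg (h0 x z)]; exact hup x z
  have hlip : ∀ x z w, |f x z - f x w| ≤ M * ‖z - w‖ := fun x =>
    abs_sub_le_of_convex hM.le (hf.comp (by fun_prop : Continuous fun z => (x, z))) (hconv x) (h0 x)
      (hup x)
  rw [relaxedEnergy_eq_ofReal h0 hf habs hlip hr]
  refine le_iInf fun u => le_iInf fun hu => le_iInf fun hc => ?_
  have hui : ∀ j, Integrable (u j) (leb Ω) := fun j => by
    simpa using (hu j).1.add hu₀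
  have ifu := fun j => integrable_comp_of_linear_growth hf habs (hui j)
  by_contra! hcon
  obtain ⟨c, hc1, hc2⟩ := ENNReal.lt_iff_exists_nnreal_btwn.1 hcon
  have hfreq : ∃ᶠ j in atTop, ∫ x, f x (u j x) ∂(leb Ω) ≤ c
      ∧ ∫ x, ‖u j x‖ ∂(leb Ω) ≤ M * c + (leb Ω).real Set.univ := by
    refine (frequently_lt_of_liminf_lt (h := hc1)).mono fun j hj => ?_
    rw [energy_eq_ofReal h0 (ifu j), ← ENNReal.ofReal_coe_nnreal] at hj
    have h1 := (ENNReal.ofReal_lt_ofReal_iff_of_nonneg (integral_nonneg fun x => h0 _ _)).1 hj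
    refine ⟨h1.le, ?_⟩
    calc ∫ x, ‖u j x‖ ∂(leb Ω) ≤ ∫ x, (M * f x (u j x) + 1) ∂(leb Ω) := by
          refine integral_mono (hui j).norm (((ifu j).const_mul M).add (integrable_const 1))
            fun x => ?_
          have h2 := mul_le_mul_of_nonneg_left (hlow x (u j x)) hM.le
          rw [← mul_assoc, mul_one_div_cancel hM.ne', one_mul] at h2
          exact sub_le_iff_le_add.1 h2
      _ = M * ∫ x, f x (u j x) ∂(leb Ω) + (leb Ω).real Set.univ := by
          rw [integral_add ((ifu j).const_mul M) (integrable_const 1), integral_const_mul,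
            integral_const, smul_eq_mul, mul_one]
      _ ≤ M * c + (leb Ω).real Set.univ := by gcongr
  have key := integral_add_integral_recession_le hf hconv h0 hM.le hup hloc
    (tendsto_recession_of_prod hr) (singularPart_mutuallySingular μ) hui
    (integrable_density μ (leb Ω)) (integrable_density (singularPart μ) (singularPart μ).variation)
    (vagueTendsto_of_weakStarTendsto hui hc) hfreq
  refine hc2.not_ge ?_
  rw [← ENNReal.ofReal_coe_nnreal]
  exact ENNReal.ofReal_le_ofReal key

/-- Reshetnyak continuity: if `v_j ℒᵈ → μ - u₀ ℒᵈ` area-strictly, then integrands with a recession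
function pass to the limit along `u₀ + v_j`. -/
theorem tendsto_integral_of_areaStrictTendsto {u₀ : Ω → Euc N} (hu₀ : Integrable u₀ (leb Ω))
    {μ : VectorMeasure Ω (Euc N)} {v : ℕ → Ω → Euc N} (hv : ∀ j, Integrable (v j) (leb Ω))
    (h : AreaStrictTendsto (fun j => toMeas (v j)) (μ - toMeas u₀)) {f r : Ω → Euc N → ℝ}
    (hf : Continuous fun q : Ω × Euc N => f q.1 q.2) {C : ℝ} (hC0 : 0 ≤ C)
    (hC : ∀ x z, |f x z| ≤ C * (1 + ‖z‖)) {L : ℝ} (hL : 0 ≤ L)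
    (hlip : ∀ x z w, |f x z - f x w| ≤ L * ‖z - w‖)
    (hr : ∀ x z, Tendsto (fun p : Ω × ℝ => f p.1 (p.2 • z) / p.2) (𝓝 x ×ˢ atTop) (𝓝 (r x z))) :
    Tendsto (fun j => ∫ x, f x ((u₀ + v j) x) ∂(leb Ω)) atTop
      (𝓝 (∫ x, f x (density μ (leb Ω) x) ∂(leb Ω)
        + ∫ x, r x (density (singularPart μ) (singularPart μ).variation x)
          ∂(singularPart μ).variation)) := by
  have : LocallyCompactSpace Ω := Ω.isOpen.locallyCompactSpace
  have hsing := singularPart_sub_toMeas μ hu₀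
  have hvague := vagueTendsto_of_weakStarTendsto hv h.1
  have harea := h.2
  simp only [area_eq_ofReal (μ - toMeas u₀), area_toMeas (hv _)] at harea
  rw [hsing] at hvague harea
  have harea' := (ENNReal.continuousAt_toReal ENNReal.ofReal_ne_top).tendsto.comp harea
  have hpos : ∀ w : Ω → Euc N, 0 ≤ ∫ x, areaIntegrand (w x) ∂(leb Ω) := fun w =>
    integral_nonneg fun x => (areaIntegrand_pos _).le
  simp only [Function.comp_def, ENNReal.toReal_ofReal (hpos _),
    ENNReal.toReal_ofReal (add_nonneg (hpos _) measureReal_nonneg)] at harea'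
  have key := tendsto_integral_add_of_areaStrict (singularPart_mutuallySingular μ) hv
    (integrable_density _ _) (integrable_density (singularPart μ) (singularPart μ).variation)
    (norm_density_variation _) hvague harea' hf hC0 hC hL hlip hr hu₀
  have e : ∫ x, f x (u₀ x + density (μ - toMeas u₀) (leb Ω) x) ∂(leb Ω)
      = ∫ x, f x (density μ (leb Ω) x) ∂(leb Ω) := by
    refine integral_congr_ae ?_
    filter_upwards [density_sub_toMeas_ae μ hu₀] with x hx
    rw [hx, Pi.sub_apply, add_sub_cancel]
  rw [e] at key
  exact key

/-- A bounded continuous test function is an integrand that is its own recession function, so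
narrow convergence is an instance of Reshetnyak continuity. -/
theorem narrowTendsto_of_areaStrictTendsto {u₀ : Ω → Euc N} (hu₀ : Integrable u₀ (leb Ω))
    {μ : VectorMeasure Ω (Euc N)} {v : ℕ → Ω → Euc N} (hv : ∀ j, Integrable (v j) (leb Ω))
    (h : AreaStrictTendsto (fun j => toMeas (v j)) (μ - toMeas u₀)) :
    NarrowTendsto (fun j => toMeas (u₀ + v j)) μ := by
  intro φ
  have hb : ∀ x z, |inner ℝ (φ x) z| ≤ ‖φ‖ * ‖z‖ := fun x z =>
    (abs_real_inner_le_norm _ _).trans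
      (mul_le_mul_of_nonneg_right (φ.norm_coe_le_norm x) (norm_nonneg z))
  have hrec : ∀ x z, Tendsto (fun p : Ω × ℝ => inner ℝ (φ p.1) (p.2 • z) / p.2) (𝓝 x ×ˢ atTop)
      (𝓝 (inner ℝ (φ x) z)) := by
    intro x z
    have h1 : Tendsto (fun p : Ω × ℝ => inner ℝ (φ p.1) z) (𝓝 x ×ˢ atTop) (𝓝 (inner ℝ (φ x) z)) :=
      ((φ.continuous.tendsto x).comp tendsto_fst).inner tendsto_const_nhds
    refine h1.congr' ?_
    filter_upwards [tendsto_snd.eventually (eventually_gt_atTop (0 : ℝ))] with p hp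
    rw [real_inner_smul_right, mul_div_cancel_left₀ _ hp.ne']
  have key := tendsto_integral_of_areaStrictTendsto hu₀ hv h
    (f := fun x z => inner ℝ (φ x) z) (r := fun x z => inner ℝ (φ x) z)
    ((φ.continuous.comp continuous_fst).inner continuous_snd) (norm_nonneg φ)
    (fun x z => (hb x z).trans
      (mul_le_mul_of_nonneg_left (le_add_of_nonneg_left zero_le_one) (norm_nonneg φ)))
    (norm_nonneg φ) (fun x z w => by rw [← inner_sub_right]; exact hb _ _) hrec
  rw [pairing_eq_integral_density μ φ.continuous φ.norm_coe_le_norm]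
  refine key.congr fun j => ?_
  exact (pairing_toMeas (hu₀.add (hv j)) φ.continuous φ.norm_coe_le_norm).symm

/-- Recovery sequences: an area-strict approximation of `μ - u₀ ℒᵈ` by elements of `ker 𝒜`,
translated by `u₀`. -/
theorem relaxation_le_relaxedEnergy (A : LinearPDO Ω N n) (hA : A.AreaStrictApprox)
    {u₀ : Ω → Euc N} (hu₀ : Integrable u₀ (leb Ω)) {f : Ω → Euc N → ℝ}
    (hf : Continuous fun q : Ω × Euc N => f q.1 q.2) (h0 : ∀ x z, 0 ≤ f x z) {C : ℝ} (hC0 : 0 ≤ C)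
    (hC : ∀ x z, |f x z| ≤ C * (1 + ‖z‖)) {L : ℝ} (hL : 0 ≤ L)
    (hlip : ∀ x z w, |f x z - f x w| ≤ L * ‖z - w‖)
    (hr : ∀ x z, Tendsto (fun p : Ω × ℝ => f p.1 (p.2 • z) / p.2) (𝓝 x ×ˢ atTop)
      (𝓝 (recession f x z)))
    {μ : VectorMeasure Ω (Euc N)} (hμ : A.MemKerMeas (μ - toMeas u₀)) :
    relaxation NarrowTendsto A f u₀ μ ≤ relaxedEnergy f μ := by
  obtain ⟨v, hvA, hv⟩ := hA _ hμ
  have hvi := fun j => (hvA j).1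
  have hlim : Tendsto (fun j => energy f (u₀ + v j)) atTop (𝓝 (relaxedEnergy f μ)) := by
    rw [relaxedEnergy_eq_ofReal h0 hf hC hlip hr]
    refine (ENNReal.tendsto_ofReal
      (tendsto_integral_of_areaStrictTendsto hu₀ hvi hv hf hC0 hC hL hlip hr)).congr fun j => ?_
    exact (energy_eq_ofReal h0
      (integrable_comp_of_linear_growth hf hC (hu₀.add (hvi j)))).symm
  refine iInf_le_of_le (fun j => u₀ + v j) (iInf_le_of_le (fun j => ?_) (iInf_le_of_le
    (narrowTendsto_of_areaStrictTendsto hu₀ hvi hv) hlim.liminf_eq.le))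
  rw [add_sub_cancel_left]
  exact hvA j

end Relaxation

end LinearGrowth

theorem theorem1p2 {d N n : ℕ} (Ω : TopologicalSpace.Opens (LinearGrowth.Euc d))
    (hΩ : volume (frontier (Ω : Set (LinearGrowth.Euc d))) = 0)
    (hΩfin : volume (Ω : Set (LinearGrowth.Euc d)) ≠ ∞)
    (A : LinearGrowth.LinearPDO Ω N n) (hA : A.AreaStrictApprox)
    (u₀ : Ω → LinearGrowth.Euc N) (hu₀ : A.MemW1 u₀)
    (f : Ω → LinearGrowth.Euc N → ℝ)
    (hf_cont : Continuous (fun p : Ω × LinearGrowth.Euc N => f p.1 p.2))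
    (hf_nonneg : ∀ x z, 0 ≤ f x z)
    (hf_conv : ∀ x, ConvexOn ℝ Set.univ (f x))
    (M : ℝ) (hM : 0 < M)
    (hf_growth : ∀ x z, 1 / M * (‖z‖ - 1) ≤ |f x z| ∧ |f x z| ≤ M * (1 + ‖z‖))
    (ω : ℝ → ℝ) (hω : Tendsto ω (𝓝[>] 0) (𝓝 0))
    (hf_mod : ∀ x y z, |f x z - f y z| ≤ ω (dist x y) * (1 + ‖z‖)) :
    (∀ x z, Tendsto (fun p : Ω × ℝ => f p.1 (p.2 • z) / p.2) (𝓝 x ×ˢ atTop)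
      (𝓝 (LinearGrowth.recession f x z))) ∧
    ∀ μ : VectorMeasure Ω (LinearGrowth.Euc N), A.MemKerMeas (μ - LinearGrowth.toMeas u₀) →
      LinearGrowth.relaxation LinearGrowth.WeakStarTendsto A f u₀ μ
          = LinearGrowth.relaxedEnergy f μ ∧
      LinearGrowth.relaxation LinearGrowth.NarrowTendsto A f u₀ μ
          = LinearGrowth.relaxedEnergy f μ := by
  have := LinearGrowth.isFiniteMeasure_leb hΩfin
  have hup : ∀ x z, f x z ≤ M * (1 + ‖z‖) := fun x z => (le_abs_self _).trans (hf_growth x z).2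
  have hlow : ∀ x z, 1 / M * (‖z‖ - 1) ≤ f x z := fun x z => by
    rw [← abs_of_nonneg (hf_nonneg x z)]
    exact (hf_growth x z).1
  have habs : ∀ x z, |f x z| ≤ M * (1 + ‖z‖) := fun x z => (hf_growth x z).2
  have hlip : ∀ x z w, |f x z - f x w| ≤ M * ‖z - w‖ := fun x =>
    LinearGrowth.abs_sub_le_of_convex hM.le
      (hf_cont.comp (by fun_prop : Continuous fun z => (x, z))) (hf_conv x) (hf_nonneg x) (hup x)
  -- The modulus `ω` says nothing at `0`, so the case `y = x` is separate.
  have hloc : ∀ x, ∀ η > 0, ∀ᶠ y in 𝓝 x, ∀ z, |f x z - f y z| ≤ η * (1 + ‖z‖) := by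
    intro x η hη
    have h1 := eventually_nhdsWithin_iff.1 (hω.eventually (eventually_lt_nhds hη))
    have h2 : Tendsto (fun y => dist x y) (𝓝 x) (𝓝 0) := by
      have h3 : Continuous fun y => dist x y := by fun_prop
      simpa using h3.tendsto x
    filter_upwards [h2.eventually h1] with y hy z
    rcases eq_or_ne x y with rfl | hxy
    · rw [sub_self, abs_zero]
      positivity
    · exact (hf_mod x y z).trans
        (mul_le_mul_of_nonneg_right (hy (dist_pos.2 hxy)).le (by positivity))
  have hr : ∀ x z, Tendsto (fun p : Ω × ℝ => f p.1 (p.2 • z) / p.2) (𝓝 x ×ˢ atTop)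
      (𝓝 (LinearGrowth.recession f x z)) := fun x z => by
    obtain ⟨l, hl⟩ := LinearGrowth.exists_tendsto_div_atTop (hf_conv x) (hlip x) z
    exact tendsto_nhds_limUnder ⟨l, LinearGrowth.tendsto_prod_recession hloc hl⟩
  refine ⟨hr, fun μ hμ => ?_⟩
  have hlower := LinearGrowth.relaxedEnergy_le_relaxation A hu₀.1 hf_cont hf_nonneg hf_conv hM hlow
    hup hloc hr μ
  have hupper := LinearGrowth.relaxation_le_relaxedEnergy A hA hu₀.1 hf_cont hf_nonneg hM.le habs
    hM.le hlip hr hμ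
  have hle := LinearGrowth.relaxation_weakStar_le_narrow A f u₀ μ
  exact ⟨(hle.trans hupper).antisymm hlower, hupper.antisymm (hlower.trans hle)⟩
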